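/- Let $I=[\xi,\eta]$ with $\xi<\eta$, and let $a:I\to\mathbb{R}$ satisfy $a(x)\ge a_0>0$ on $I$. Let $G\subset\mathbb{C}$ be an open set containing $I$, and suppose that $i\sqrt a$ extends to a bounded holomorphic function $s$ on $G$. For $\sigma\in\{+,-\}$ define functions $(S_n^\sigma)'$ on $I$ by $(S_0^{\pm})'=\pm i\sqrt a$ and $$(S_n^{\sigma})'=-\frac{1}{2(S_0^{\sigma})'}\Big(\sum_{j=1}^{n-1}(S_j^{\sigma})'(S_{n-j}^{\sigma})'+(S_{n-1}^{\sigma})''\Big),\quad n\ge 1,$$ and put $S_n^{\sigma}(x)=\int_\xi^x (S_n^{\sigma})'(\tau)\,d\tau$. For $\varepsilon>0$, $N\in\mathbb{N}_0$ and $\varphi_0,\varphi_1\in\mathbb{C}$ let $$\varphi_N^{WKB}=\alpha_{N,\varepsilon}\exp\Big(\sum_{n=0}^N\varepsilon^{n-1}S_n^-\Big)+\beta_{N,\varepsilon}\exp\Big(\sum_{n=0}^N\varepsilon^{n-1}S_n^+\Big),$$ $$\alpha_{N,\varepsilon}=\frac{\varphi_0\sum_{n=0}^N\varepsilon^n(S_n^+)'(\xi)-\varphi_1}{D_{N,\varepsilon}},\quad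 \beta_{N,\varepsilon}=\frac{\varphi_1-\varphi_0\sum_{n=0}^N\varepsilon^n(S_n^-)'(\xi)}{D_{N,\varepsilon}},\quad D_{N,\varepsilon}=\sum_{n=0}^N\varepsilon^n\big((S_n^+)'(\xi)-(S_n^-)'(\xi)\big),$$ which is defined whenever $D_{N,\varepsilon}\ne 0$. Call constants $K_1,K_2>0$ admissible if, for both signs and all $n\in\mathbb{N}_0$, $k\ge 1$ (with $0^0=1$), $$\|S_n\|_{L^\infty(I)}\le(\eta-\xi)\|s\|_{L^\infty(G)}K_2^n n^n,\qquad \|S_n^{(k)}\|_{L^\infty(I)}\le\|s\|_{L^\infty(G)}(k-1)!\,K_1^{k-1}K_2^n n^n .$$ Then admissible constants exist. Moreover, for all admissible $K_1,K_2$ there is a function $N:(0,1)\to\{1,2,\dots\}$ with $D_{N(\varepsilon),\varepsilon}\neq0$ for all $\varepsilon\in(0,1)$, which is proportional to $1/\varepsilon$ up to rounding for small $\varepsilon$ (there are $\kappa>0$, $\varepsilon_0\in(0,1)$ with $N(\varepsilon)=\lfloor\kappa/\varepsilon\rfloor$ for $0<\varepsilon\le\varepsilon_0$), and there is $c>0$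 such that the following holds. For every $R$ there are constants $C_1,C_2,C_3>0$, independent of $\varepsilon$, such that for all $\varepsilon\in(0,1)$, all $\varphi_0,\varphi_1\in\mathbb{C}$ with $|\varphi_0|,|\varphi_1|\le R$, and the solution $\varphi$ of $$\varepsilon^2\varphi''+a\varphi=0\ \text{ on } I,\qquad \varphi(\xi)=\varphi_0,\quad \varepsilon\varphi'(\xi)=\varphi_1,$$ one has $$\|\varphi-\varphi_{N(\varepsilon)}^{WKB}\|_{L^\infty(I)}\le\frac{C_1}{\varepsilon}\exp\Big(-\frac{1}{eK_2\varepsilon}\Big)+\frac{C_2}{\varepsilon^2}\exp\Big(-\frac{\ln(e/2)}{eK_2\varepsilon}\Big),$$ and the optimally truncated error satisfies $$\inf_{N\in\mathbb{N}_0,\ D_{N,\varepsilon}\ne0}\|\varphi-\varphi_N^{WKB}\|_{L^\infty(I)}\le\frac{C_3}{\varepsilon^2}\exp\Big(-\frac{c}{\varepsilon}\Big).$$ -/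

import Mathlib

open Set MeasureTheory
open scoped ENNReal

noncomputable section

namespace WKB

/-- The norm of `L^∞(D)` (essential supremum with respect to Lebesgue measure), with values
in `[0, ∞]`. -/
def linftyNorm {X : Type*} [MeasureSpace X] (f : X → ℂ) (D : Set X) : ℝ≥0∞ :=
  eLpNorm f ∞ (volume.restrict D)

/-- The functions `S_n'` on `[ξ, η]` produced by the WKB recursion from `S_0' = s`:
`S_n' = -(1 / (2 S_0')) (∑_{j=1}^{n-1} S_j' S_{n-j}' + S_{n-1}'')` for `n ≥ 1`
(for `n = 1` the sum is empty). -/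
def dS (ξ η : ℝ) (s : ℝ → ℂ) : ℕ → ℝ → ℂ
  | 0 => s
  | n + 1 => fun x =>
      -(1 / (2 * s x)) *
        ((∑ j : Fin n, dS ξ η s (j.1 + 1) x * dS ξ η s (n - j.1) x)
          + derivWithin (dS ξ η s n) (Icc ξ η) x)
  termination_by n => n
  decreasing_by all_goals omega

theorem dS_zero (ξ η : ℝ) (s : ℝ → ℂ) : dS ξ η s 0 = s := by
  rw [dS]

theorem dS_succ (ξ η : ℝ) (s : ℝ → ℂ) (n : ℕ) (x : ℝ) :
    dS ξ η s (n + 1) x = -(1 / (2 * s x)) *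
      ((∑ j ∈ Finset.Icc 1 n, dS ξ η s j x * dS ξ η s (n + 1 - j) x)
        + derivWithin (dS ξ η s n) (Icc ξ η) x) := by
  rw [dS]
  beta_reduce
  rw [Fin.sum_univ_eq_sum_range (fun j => dS ξ η s (j + 1) x * dS ξ η s (n - j) x) n,
    Finset.range_eq_Ico,
    show Finset.Icc 1 n = Finset.Ico (0 + 1) (n + 1) by ext; simp,
    ← Finset.sum_Ico_add' (fun j => dS ξ η s j x * dS ξ η s (n + 1 - j) x) 0 n 1]
  simp only [Nat.add_sub_add_right]

/-- `S_0' = ± i √a`, the sign being `σ`. -/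
def s0 (a : ℝ → ℝ) (σ : ℤˣ) (x : ℝ) : ℂ :=
  ((σ : ℤ) : ℂ) * (Complex.I * (Real.sqrt (a x) : ℂ))

/-- The derivatives `(S_n^±)'`, the sign being `σ`. -/
def dSpm (ξ η : ℝ) (a : ℝ → ℝ) (σ : ℤˣ) (n : ℕ) : ℝ → ℂ :=
  dS ξ η (s0 a σ) n

/-- `S_n^±(x) = ∫_ξ^x (S_n^±)'(τ) dτ`, the sign being `σ`. -/
def Spm (ξ η : ℝ) (a : ℝ → ℝ) (σ : ℤˣ) (n : ℕ) (x : ℝ) : ℂ :=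
  ∫ τ in ξ..x, dSpm ξ η a σ n τ

/-- `∑_{n=0}^N ε^n (S_n^±)'(ξ)`. -/
def slopeSum (ξ η : ℝ) (a : ℝ → ℝ) (ε : ℝ) (N : ℕ) (σ : ℤˣ) : ℂ :=
  ∑ n ∈ Finset.range (N + 1), (ε : ℂ) ^ n * dSpm ξ η a σ n ξ

/-- The common denominator `∑_{n=0}^N ε^n ((S_n^+)'(ξ) - (S_n^-)'(ξ))` of `α_{N,ε}` and
`β_{N,ε}`. -/
def denom (ξ η : ℝ) (a : ℝ → ℝ) (ε : ℝ) (N : ℕ) : ℂ :=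
  ∑ n ∈ Finset.range (N + 1), (ε : ℂ) ^ n * (dSpm ξ η a 1 n ξ - dSpm ξ η a (-1) n ξ)

/-- The coefficient `α_{N,ε}`. -/
def alpha (ξ η : ℝ) (a : ℝ → ℝ) (ε : ℝ) (φ₀ φ₁ : ℂ) (N : ℕ) : ℂ :=
  (φ₀ * slopeSum ξ η a ε N 1 - φ₁) / denom ξ η a ε N

/-- The coefficient `β_{N,ε}`. -/
def beta (ξ η : ℝ) (a : ℝ → ℝ) (ε : ℝ) (φ₀ φ₁ : ℂ) (N : ℕ) : ℂ :=
  (φ₁ - φ₀ * slopeSum ξ η a ε N (-1)) / denom ξ η a ε N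

/-- The truncated WKB series `∑_{n=0}^N ε^{n-1} S_n^±(x)`. -/
def expo (ξ η : ℝ) (a : ℝ → ℝ) (ε : ℝ) (N : ℕ) (σ : ℤˣ) (x : ℝ) : ℂ :=
  ∑ n ∈ Finset.range (N + 1), (ε : ℂ) ^ ((n : ℤ) - 1) * Spm ξ η a σ n x

/-- The WKB approximation `φ_N^{WKB}`; it is well defined when `denom ξ η a ε N ≠ 0`. -/
def phiWKB (ξ η : ℝ) (a : ℝ → ℝ) (ε : ℝ) (φ₀ φ₁ : ℂ) (N : ℕ) (x : ℝ) : ℂ :=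
  alpha ξ η a ε φ₀ φ₁ N * Complex.exp (expo ξ η a ε N (-1) x)
    + beta ξ η a ε φ₀ φ₁ N * Complex.exp (expo ξ η a ε N 1 x)

/-- `φ` is a (classical) solution on `[ξ, η]` of `ε² φ'' + a φ = 0`, `φ(ξ) = φ₀`,
`ε φ'(ξ) = φ₁`. -/
structure IsSolution (ξ η : ℝ) (a : ℝ → ℝ) (ε : ℝ) (φ₀ φ₁ : ℂ) (φ : ℝ → ℂ) : Prop where
  contDiffOn : ContDiffOn ℝ 2 φ (Icc ξ η)
  ode : ∀ x ∈ Icc ξ η,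
    (ε : ℂ) ^ 2 * iteratedDerivWithin 2 φ (Icc ξ η) x + (a x : ℂ) * φ x = 0
  init : φ ξ = φ₀
  init_deriv : (ε : ℂ) * derivWithin φ (Icc ξ η) ξ = φ₁

/-- `‖φ - φ_N^{WKB}‖_{L^∞(I)}`. -/
def error (ξ η : ℝ) (a : ℝ → ℝ) (ε : ℝ) (φ₀ φ₁ : ℂ) (φ : ℝ → ℂ) (N : ℕ) : ℝ≥0∞ :=
  linftyNorm (fun x => φ x - phiWKB ξ η a ε φ₀ φ₁ N x) (Icc ξ η)

/-- The error under optimal truncation: the infimum of the errors over all truncation orders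
for which the WKB approximation is defined (the error at `N_opt`, whenever a minimizer `N_opt`
exists). -/
def optimalError (ξ η : ℝ) (a : ℝ → ℝ) (ε : ℝ) (φ₀ φ₁ : ℂ) (φ : ℝ → ℂ) : ℝ≥0∞ :=
  ⨅ (N : ℕ) (_ : denom ξ η a ε N ≠ 0), error ξ η a ε φ₀ φ₁ φ N

/-- `K₁, K₂ > 0` are admissible constants in the estimates, for both signs and all `n ≥ 0`,
`‖S_n‖_{L^∞(I)} ≤ (η - ξ) M K₂^n n^n` and
`‖S_n^{(k)}‖_{L^∞(I)} ≤ M (k-1)! K₁^{k-1} K₂^n n^n` for `k ≥ 1`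
(with `0^0 = 1`), where `M` stands for `‖S_0'‖_{L^∞(G)}`. -/
structure SeriesBounds (ξ η : ℝ) (a : ℝ → ℝ) (M : ℝ≥0∞) (K₁ K₂ : ℝ) : Prop where
  pos₁ : 0 < K₁
  pos₂ : 0 < K₂
  bound : ∀ (σ : ℤˣ) (n : ℕ),
    linftyNorm (Spm ξ η a σ n) (Icc ξ η)
      ≤ ENNReal.ofReal (η - ξ) * M * ENNReal.ofReal (K₂ ^ n * (n : ℝ) ^ n)
  bound_deriv : ∀ (σ : ℤˣ) (n k : ℕ), 1 ≤ k →
    linftyNorm (iteratedDerivWithin k (Spm ξ η a σ n) (Icc ξ η)) (Icc ξ η)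
      ≤ M * ENNReal.ofReal
          (((k - 1).factorial : ℝ) * K₁ ^ (k - 1) * K₂ ^ n * (n : ℝ) ^ n)

end WKB

end

/-
The square root `s` extends each `S_n'` to a holomorphic function near the interval, where Cauchy's
estimate on shrinking neighbourhoods (Nagumo's lemma) yields a bound `M K₂ⁿ nⁿ`. The truncated
series `u = ∑_{n ≤ N} εⁿ S_n'` solves the Riccati equation `u² + ε u' + a = 0` up to the terms of
order greater than `N`. As long as `ε K₂ N ≤ q = 1 / e`, the factorially growing terms are dominated
by a geometric series in `q`, so that this residual is of size `ε² N⁴ q^(N - 1)`; with `N` close to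
`1 / (e K₂ ε)` it is exponentially small. The exponentials `exp (∑ εⁿ⁻¹ S_n)` stay bounded because
`S_0` is purely imaginary, so `φ_N^{WKB}` solves the oscillator equation up to a similar residual,
and Grönwall's inequality for the energy `a |e|² + ε² |e'|²` of the error `e` concludes.
-/

noncomputable section

namespace WKB

/-! ### Pointwise bounds and `L^∞` bounds -/

theorem linftyNorm_le_of_forall {X : Type*} [MeasureSpace X] {f : X → ℂ} {D : Set X}
    (hD : MeasurableSet D) {C : ℝ} (h : ∀ x ∈ D, ‖f x‖ ≤ C) :
    linftyNorm f D ≤ ENNReal.ofReal C := by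
  rw [linftyNorm, eLpNorm_exponent_top]
  exact eLpNormEssSup_le_of_ae_bound ((ae_restrict_iff' hD).2 (.of_forall h))

theorem norm_le_of_linftyNorm_le {X : Type*} [TopologicalSpace X] [MeasureSpace X]
    [OpensMeasurableSpace X] [(volume : Measure X).IsOpenPosMeasure] {f : X → ℂ} {D : Set X}
    (hD : D ⊆ closure (interior D)) (hf : ContinuousOn f D) {C : ℝ} (hC : 0 ≤ C)
    (h : linftyNorm f D ≤ ENNReal.ofReal C) : ∀ x ∈ D, ‖f x‖ ≤ C := by
  rw [linftyNorm, eLpNorm_exponent_top] at h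
  have hae : (fun x => max ‖f x‖ C) =ᵐ[volume.restrict D] fun _ => C := by
    filter_upwards [ae_le_eLpNormEssSup (f := f) (μ := volume.restrict D)] with x hx
    rw [max_eq_right_iff, ← ENNReal.ofReal_le_ofReal_iff hC, ofReal_norm]
    exact hx.trans h
  intro x hx
  exact max_eq_right_iff.1
    (Measure.eqOn_of_ae_eq hae (hf.norm.sup continuousOn_const) continuousOn_const hD hx)

theorem norm_le_toReal_linftyNorm {X : Type*} [TopologicalSpace X] [MeasureSpace X]
    [OpensMeasurableSpace X] [(volume : Measure X).IsOpenPosMeasure] {f : X → ℂ} {U : Set X}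
    (hU : IsOpen U) (hf : ContinuousOn f U) (h : linftyNorm f U < ⊤) :
    ∀ x ∈ U, ‖f x‖ ≤ (linftyNorm f U).toReal :=
  norm_le_of_linftyNorm_le (by simpa only [hU.interior_eq] using subset_closure) hf
    ENNReal.toReal_nonneg (ENNReal.ofReal_toReal h.ne).ge

/-! ### The recursion in the complex domain -/

/-- The WKB recursion `dS` for holomorphic functions, with the complex derivative in place of the
derivative along the interval. -/
def cdS (s : ℂ → ℂ) : ℕ → ℂ → ℂ
  | 0 => s
  | n + 1 => fun z =>
      -(1 / (2 * s z)) *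
        ((∑ j : Fin n, cdS s (j.1 + 1) z * cdS s (n - j.1) z) + deriv (cdS s n) z)
  termination_by n => n
  decreasing_by all_goals omega

theorem cdS_zero (s : ℂ → ℂ) : cdS s 0 = s := by
  rw [cdS]

theorem cdS_succ (s : ℂ → ℂ) (n : ℕ) (z : ℂ) :
    cdS s (n + 1) z = -(1 / (2 * s z)) *
      ((∑ j ∈ Finset.Icc 1 n, cdS s j z * cdS s (n + 1 - j) z) + deriv (cdS s n) z) := by
  rw [cdS]
  beta_reduce
  rw [Fin.sum_univ_eq_sum_range (fun j => cdS s (j + 1) z * cdS s (n - j) z) n,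
    Finset.range_eq_Ico,
    show Finset.Icc 1 n = Finset.Ico (0 + 1) (n + 1) by ext; simp,
    ← Finset.sum_Ico_add' (fun j => cdS s j z * cdS s (n + 1 - j) z) 0 n 1]
  simp only [Nat.add_sub_add_right]

theorem differentiableOn_cdS {s : ℂ → ℂ} {U : Set ℂ} (hU : IsOpen U)
    (hs : DifferentiableOn ℂ s U) (h0 : ∀ z ∈ U, s z ≠ 0) (n : ℕ) :
    DifferentiableOn ℂ (cdS s n) U := by
  induction n using Nat.strong_induction_on with
  | _ n ih =>
    rcases n with _ | n
    · rwa [cdS_zero]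
    · rw [funext (cdS_succ s n)]
      have hfactor : DifferentiableOn ℂ (fun z => -(1 / (2 * s z))) U :=
        ((differentiableOn_const 1).div (hs.const_mul 2)
          fun z hz => mul_ne_zero two_ne_zero (h0 z hz)).neg
      refine hfactor.mul (DifferentiableOn.add ?_ ((ih n n.lt_succ_self).deriv hU))
      refine DifferentiableOn.fun_sum fun j hj => ?_
      rw [Finset.mem_Icc] at hj
      exact (ih j (by omega)).mul (ih _ (by omega))

theorem norm_deriv_le_of_thickening {f : ℂ → ℂ} {T : Set ℂ} {r r' C : ℝ} (hr : r' < r)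
    (hf : DifferentiableOn ℂ f (Metric.thickening r T))
    (hC : ∀ z ∈ Metric.thickening r T, ‖f z‖ ≤ C) {z : ℂ} (hz : z ∈ Metric.thickening r' T) :
    ‖deriv f z‖ ≤ C / (r - r') := by
  have hsub : Metric.closedBall z (r - r') ⊆ Metric.thickening r T := by
    intro w hw
    obtain ⟨x, hx, hzx⟩ := Metric.mem_thickening_iff.1 hz
    refine Metric.mem_thickening_iff.2 ⟨x, hx, ?_⟩
    have := dist_triangle w z x
    rw [Metric.mem_closedBall] at hw
    linarith
  exact Complex.norm_deriv_le_of_forall_mem_sphere_norm_le (sub_pos.2 hr)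
    (hf.diffContOnCl_ball hsub) fun w hw => hC w (hsub (Metric.sphere_subset_closedBall hw))

/-- Nagumo's lemma: Cauchy's estimate on the disc of radius `ρ / (n + 2)` about `z`. -/
theorem norm_deriv_le_of_norm_le_div_pow {f : ℂ → ℂ} {T : Set ℂ} {δ C : ℝ} (hC : 0 ≤ C) (n : ℕ)
    (hf : DifferentiableOn ℂ f (Metric.thickening δ T))
    (hfC : ∀ ρ > 0, ∀ z ∈ Metric.thickening (δ - ρ) T, ‖f z‖ ≤ C / ρ ^ n)
    {ρ : ℝ} (hρ : 0 < ρ) {z : ℂ} (hz : z ∈ Metric.thickening (δ - ρ) T) :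
    ‖deriv f z‖ ≤ Real.exp 1 * C * (n + 1) / ρ ^ (n + 1) := by
  set ρ' : ℝ := ρ / (1 + ((n + 1 : ℕ) : ℝ)⁻¹) with hρ'
  have hρ'_pos : 0 < ρ' := by positivity
  have hsub : ρ - ρ' = ρ / (n + 2) := by
    rw [hρ']
    push_cast
    field_simp
    ring
  have hlt : δ - ρ < δ - ρ' := by
    have : 0 < ρ / (n + 2) := by positivity
    linarith
  have hcauchy := norm_deriv_le_of_thickening hlt
    (hf.mono (Metric.thickening_mono (by linarith) T)) (hfC ρ' hρ'_pos) hz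
  calc ‖deriv f z‖ ≤ C / ρ' ^ n / (δ - ρ' - (δ - ρ)) := hcauchy
    _ = (1 + ((n + 1 : ℕ) : ℝ)⁻¹) ^ (n + 1) * C * (n + 1) / ρ ^ (n + 1) := by
      rw [sub_sub_sub_cancel_left, hsub, hρ', div_pow, pow_succ (1 + _), pow_succ ρ]
      push_cast
      field_simp
      ring
    _ ≤ Real.exp 1 * C * (n + 1) / ρ ^ (n + 1) := by
      gcongr
      exact Real.one_add_inv_pow_le_exp

theorem factorial_succ_mul_factorial_succ_le (i l : ℕ) :
    (i + 1).factorial * (l + 1).factorial ≤ (i + l + 1).factorial := by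
  induction l with
  | zero => simp
  | succ l ih =>
    rw [Nat.factorial_succ (l + 1), Nat.mul_left_comm, ← add_assoc, Nat.factorial_succ (i + l + 1)]
    exact Nat.mul_le_mul (by omega) ih

theorem sum_factorial_mul_factorial_le (n : ℕ) :
    ∑ j ∈ Finset.Icc 1 n, j.factorial * (n + 1 - j).factorial ≤ (n + 1).factorial := by
  have hterm : ∀ j ∈ Finset.Icc 1 n, j.factorial * (n + 1 - j).factorial ≤ n.factorial := by
    intro j hj
    rw [Finset.mem_Icc] at hj
    obtain ⟨i, rfl⟩ : ∃ i, j = i + 1 := ⟨j - 1, by omega⟩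
    obtain ⟨l, rfl⟩ : ∃ l, n = i + l + 1 := ⟨n - i - 1, by omega⟩
    rw [show i + l + 1 + 1 - (i + 1) = l + 1 by omega]
    exact factorial_succ_mul_factorial_succ_le i l
  calc ∑ j ∈ Finset.Icc 1 n, j.factorial * (n + 1 - j).factorial
      ≤ n * n.factorial := by simpa using Finset.sum_le_sum hterm
    _ ≤ (n + 1).factorial := by
      rw [Nat.factorial_succ]
      gcongr
      exact n.le_succ

theorem norm_sum_mul_le_of_norm_le_factorial {f : ℕ → ℂ} {B X : ℝ} (hX : 0 ≤ X) (n : ℕ)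
    (hf : ∀ j ∈ Finset.Icc 1 n, ‖f j‖ ≤ B * X ^ j * j.factorial) :
    ‖∑ j ∈ Finset.Icc 1 n, f j * f (n + 1 - j)‖ ≤ B ^ 2 * X ^ (n + 1) * (n + 1).factorial := by
  calc ‖∑ j ∈ Finset.Icc 1 n, f j * f (n + 1 - j)‖
      ≤ ∑ j ∈ Finset.Icc 1 n, B ^ 2 * X ^ (n + 1) * (j.factorial * (n + 1 - j).factorial : ℕ) := by
        refine norm_sum_le_of_le _ fun j hj => ?_
        have hj' := Finset.mem_Icc.1 hj
        have hfj := hf j hj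
        have hfl := hf (n + 1 - j) (Finset.mem_Icc.2 (by omega))
        have hpow : X ^ (n + 1) = X ^ j * X ^ (n + 1 - j) := by rw [← pow_add]; congr 1; omega
        calc ‖f j * f (n + 1 - j)‖
            ≤ B * X ^ j * j.factorial * (B * X ^ (n + 1 - j) * (n + 1 - j).factorial) := by
              rw [norm_mul]
              exact mul_le_mul hfj hfl (norm_nonneg _) ((norm_nonneg _).trans hfj)
          _ = B ^ 2 * X ^ (n + 1) * (j.factorial * (n + 1 - j).factorial : ℕ) := by
              rw [hpow]
              push_cast
              ring
    _ ≤ B ^ 2 * X ^ (n + 1) * (n + 1).factorial := by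
        rw [← Finset.mul_sum, ← Nat.cast_sum]
        gcongr
        exact sum_factorial_mul_factorial_le n

theorem norm_cdS_succ_le {s : ℂ → ℂ} {z : ℂ} {m Y : ℝ} {n : ℕ} (hm : 0 < m) (hsz : m ≤ ‖s z‖)
    (hsum : ‖∑ j ∈ Finset.Icc 1 n, cdS s j z * cdS s (n + 1 - j) z‖ ≤ m ^ 2 * Y)
    (hderiv : ‖deriv (cdS s n) z‖ ≤ m ^ 2 * Y) :
    ‖cdS s (n + 1) z‖ ≤ m * Y := by
  calc ‖cdS s (n + 1) z‖
      = 1 / (2 * ‖s z‖) * ‖(∑ j ∈ Finset.Icc 1 n, cdS s j z * cdS s (n + 1 - j) z)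
          + deriv (cdS s n) z‖ := by
        rw [cdS_succ, norm_mul, norm_neg, norm_div, norm_one, norm_mul, Complex.norm_ofNat]
    _ ≤ 1 / (2 * m) * (m ^ 2 * Y + m ^ 2 * Y) := by
        gcongr
        exact norm_add_le_of_le hsum hderiv
    _ = m * Y := by
        field_simp
        ring

theorem norm_cdS_succ_le_factorial {s : ℂ → ℂ} {T : Set ℂ} {δ m M K : ℝ} (hm : 0 < m)
    (hmM : m ≤ M) (hK : K = Real.exp 1 * M / m ^ 2)
    (hs : DifferentiableOn ℂ s (Metric.thickening δ T))
    (hsm : ∀ z ∈ Metric.thickening δ T, m ≤ ‖s z‖)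
    (hsM : ∀ z ∈ Metric.thickening δ T, ‖s z‖ ≤ M) (n : ℕ) :
    ∀ ρ > 0, ∀ z ∈ Metric.thickening (δ - ρ) T,
      ‖cdS s (n + 1) z‖ ≤ m * (K / ρ) ^ (n + 1) * (n + 1).factorial := by
  have hM : 0 < M := hm.trans_le hmM
  have hK_pos : 0 < K := by rw [hK]; positivity
  have h0 : ∀ z ∈ Metric.thickening δ T, s z ≠ 0 :=
    fun z hz => norm_pos_iff.1 (hm.trans_le (hsm z hz))
  have hmono : ∀ ρ > 0, Metric.thickening (δ - ρ) T ⊆ Metric.thickening δ T :=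
    fun ρ hρ => Metric.thickening_mono (by linarith) T
  induction n using Nat.strong_induction_on with
  | _ n ih =>
    intro ρ hρ z hz
    have hsz := hsm z (hmono ρ hρ hz)
    have hn : ∀ ρ > 0, ∀ z ∈ Metric.thickening (δ - ρ) T,
        ‖cdS s n z‖ ≤ M * K ^ n * n.factorial / ρ ^ n := by
      intro ρ hρ z hz
      rcases n with _ | n
      · simpa [cdS_zero] using hsM z (hmono ρ hρ hz)
      · rw [mul_div_right_comm, mul_div_assoc, ← div_pow]
        refine (ih n n.lt_succ_self ρ hρ z hz).trans ?_
        gcongr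
    have hderiv : ‖deriv (cdS s n) z‖ ≤ m ^ 2 * ((K / ρ) ^ (n + 1) * (n + 1).factorial) := by
      refine (norm_deriv_le_of_norm_le_div_pow (by positivity) n
        (differentiableOn_cdS Metric.isOpen_thickening hs h0 n) hn hρ hz).trans_eq ?_
      rw [div_pow, pow_succ K n, Nat.factorial_succ]
      nth_rw 3 [hK]
      push_cast
      field_simp
    have hsum : ‖∑ j ∈ Finset.Icc 1 n, cdS s j z * cdS s (n + 1 - j) z‖
        ≤ m ^ 2 * ((K / ρ) ^ (n + 1) * (n + 1).factorial) := by
      rw [← mul_assoc]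
      refine norm_sum_mul_le_of_norm_le_factorial (by positivity) n fun j hj => ?_
      rw [Finset.mem_Icc] at hj
      obtain ⟨i, rfl⟩ : ∃ i, j = i + 1 := ⟨j - 1, by omega⟩
      exact ih i (by omega) ρ hρ z hz
    exact (norm_cdS_succ_le hm hsz hsum hderiv).trans_eq (mul_assoc _ _ _).symm

/-! ### From the complex domain to the interval -/

/-- `F` is a holomorphic extension of `f`, given on the real set `D`, to the open set `U ⊇ D` of
complex numbers. -/
structure HolomorphicExtension (f : ℝ → ℂ) (D : Set ℝ) (F : ℂ → ℂ) (U : Set ℂ) : Prop where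
  isOpen : IsOpen U
  mem : ∀ x ∈ D, (x : ℂ) ∈ U
  differentiableOn : DifferentiableOn ℂ F U
  eq : ∀ x ∈ D, f x = F x

theorem HolomorphicExtension.mono {f : ℝ → ℂ} {D : Set ℝ} {F : ℂ → ℂ} {U V : Set ℂ}
    (h : HolomorphicExtension f D F U) (hV : IsOpen V) (hDV : ∀ x ∈ D, (x : ℂ) ∈ V)
    (hVU : V ⊆ U) : HolomorphicExtension f D F V :=
  ⟨hV, hDV, h.differentiableOn.mono hVU, h.eq⟩

theorem HolomorphicExtension.contDiffOn {f : ℝ → ℂ} {D : Set ℝ} {F : ℂ → ℂ} {U : Set ℂ}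
    (h : HolomorphicExtension f D F U) (n : ℕ∞) : ContDiffOn ℝ n f D := by
  have hF : ContDiffOn ℝ n F U := (h.differentiableOn.contDiffOn h.isOpen).restrict_scalars ℝ
  exact (hF.comp Complex.ofRealCLM.contDiff.contDiffOn h.mem).congr h.eq

theorem HolomorphicExtension.derivWithin {f : ℝ → ℂ} {D : Set ℝ} {F : ℂ → ℂ} {U : Set ℂ}
    (h : HolomorphicExtension f D F U) (hD : UniqueDiffOn ℝ D) :
    HolomorphicExtension (derivWithin f D) D (deriv F) U where
  isOpen := h.isOpen
  mem := h.mem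
  differentiableOn := h.differentiableOn.deriv h.isOpen
  eq x hx := ((h.differentiableOn.differentiableAt (h.isOpen.mem_nhds
    (h.mem x hx))).hasDerivAt.comp_ofReal.hasDerivWithinAt.congr h.eq (h.eq x hx)).derivWithin
    (hD x hx)

theorem HolomorphicExtension.iteratedDerivWithin {f : ℝ → ℂ} {D : Set ℝ} {F : ℂ → ℂ} {U : Set ℂ}
    (h : HolomorphicExtension f D F U) (hD : UniqueDiffOn ℝ D) (k : ℕ) :
    HolomorphicExtension (iteratedDerivWithin k f D) D (iteratedDeriv k F) U := by
  induction k with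
  | zero => rwa [iteratedDerivWithin_zero, iteratedDeriv_zero]
  | succ k ih =>
    rw [iteratedDeriv_succ, iteratedDerivWithin_succ]
    exact ih.derivWithin hD

theorem HolomorphicExtension.dS {ξ η : ℝ} (hξη : ξ < η) {f : ℝ → ℂ} {F : ℂ → ℂ} {U : Set ℂ}
    (h : HolomorphicExtension f (Icc ξ η) F U) (h0 : ∀ z ∈ U, F z ≠ 0) (n : ℕ) :
    HolomorphicExtension (dS ξ η f n) (Icc ξ η) (cdS F n) U where
  isOpen := h.isOpen
  mem := h.mem
  differentiableOn := differentiableOn_cdS h.isOpen h.differentiableOn h0 n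
  eq := by
    induction n using Nat.strong_induction_on with
    | _ n ih =>
      intro x hx
      rcases n with _ | n
      · rw [dS_zero, cdS_zero, h.eq x hx]
      · have hn : HolomorphicExtension (WKB.dS ξ η f n) (Icc ξ η) (cdS F n) U :=
          ⟨h.isOpen, h.mem, differentiableOn_cdS h.isOpen h.differentiableOn h0 n,
            ih n n.lt_succ_self⟩
        rw [dS_succ, cdS_succ, h.eq x hx, (hn.derivWithin (uniqueDiffOn_Icc hξη)).eq x hx]
        congr 2
        refine Finset.sum_congr rfl fun j hj => ?_
        rw [Finset.mem_Icc] at hj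
        rw [ih j (by omega) x hx, ih (n + 1 - j) (by omega) x hx]

theorem hasDerivWithinAt_integral_Icc {E : Type*} [NormedAddCommGroup E] [NormedSpace ℝ E]
    [CompleteSpace E] {ξ η : ℝ} {f : ℝ → E} (hf : ContinuousOn f (Icc ξ η)) {x : ℝ}
    (hx : x ∈ Icc ξ η) :
    HasDerivWithinAt (fun u => ∫ τ in ξ..u, f τ) (f x) (Icc ξ η) x := by
  have : Fact (x ∈ Icc ξ η) := ⟨hx⟩
  refine intervalIntegral.integral_hasDerivWithinAt_right ?_
    (hf.stronglyMeasurableAtFilter_nhdsWithin measurableSet_Icc x) (hf x hx)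
  refine (hf.mono ?_).intervalIntegrable
  rw [uIcc_of_le hx.1]
  exact Icc_subset_Icc_right hx.2

theorem HolomorphicExtension.iteratedDerivWithin_succ_integral {ξ η : ℝ} (hξη : ξ < η)
    {f : ℝ → ℂ} {F : ℂ → ℂ} {U : Set ℂ} (h : HolomorphicExtension f (Icc ξ η) F U) (k : ℕ) {x : ℝ}
    (hx : x ∈ Icc ξ η) :
    _root_.iteratedDerivWithin (k + 1) (fun u => ∫ τ in ξ..u, f τ) (Icc ξ η) x
      = iteratedDeriv k F x := by
  have hD := uniqueDiffOn_Icc hξη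
  have hderiv : EqOn (_root_.derivWithin (fun u => ∫ τ in ξ..u, f τ) (Icc ξ η)) f (Icc ξ η) :=
    fun y hy => (hasDerivWithinAt_integral_Icc (h.contDiffOn 0).continuousOn hy).derivWithin
      (hD y hy)
  rw [iteratedDerivWithin_succ', iteratedDerivWithin_congr hderiv hx,
    (h.iteratedDerivWithin hD k).eq x hx]

/-! ### Existence of admissible constants -/

theorem exists_thickening_norm_ge {X E : Type*} [PseudoMetricSpace X] [SeminormedAddCommGroup E]
    {T G : Set X} (hT : IsCompact T) (hG : IsOpen G) (hTG : T ⊆ G) {s : X → E}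
    (hs : ContinuousOn s G) {m : ℝ} (hm : ∀ z ∈ T, m < ‖s z‖) :
    ∃ δ > 0, Metric.thickening δ T ⊆ G ∧ ∀ z ∈ Metric.thickening δ T, m ≤ ‖s z‖ := by
  obtain ⟨δ, hδ, hsub⟩ := hT.exists_thickening_subset_open
    (hs.norm.isOpen_inter_preimage hG (isOpen_Ioi (a := m))) fun z hz => ⟨hTG hz, hm z hz⟩
  exact ⟨δ, hδ, fun z hz => (hsub hz).1, fun z hz => (hsub hz).2.le⟩

theorem HolomorphicExtension.exists_thickening {f : ℝ → ℂ} {D : Set ℝ} {F : ℂ → ℂ} {U : Set ℂ}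
    (h : HolomorphicExtension f D F U) (hD : IsCompact D) {m : ℝ} (hm : ∀ x ∈ D, m < ‖f x‖) :
    ∃ δ > 0, Metric.thickening δ (Complex.ofReal '' D) ⊆ U ∧
      HolomorphicExtension f D F (Metric.thickening δ (Complex.ofReal '' D)) ∧
      ∀ z ∈ Metric.thickening δ (Complex.ofReal '' D), m ≤ ‖F z‖ := by
  have hnorm : ∀ z ∈ Complex.ofReal '' D, m < ‖F z‖ := by
    rintro _ ⟨x, hx, rfl⟩
    exact h.eq x hx ▸ hm x hx
  obtain ⟨δ, hδ, hsub, hle⟩ := exists_thickening_norm_ge (hD.image Complex.continuous_ofReal)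
    h.isOpen (image_subset_iff.2 h.mem) h.differentiableOn.continuousOn hnorm
  exact ⟨δ, hδ, hsub, h.mono Metric.isOpen_thickening (fun x hx =>
    Metric.self_subset_thickening hδ _ (mem_image_of_mem _ hx)) hsub, hle⟩

theorem norm_intUnit_mul (σ : ℤˣ) (z : ℂ) : ‖((σ : ℤ) : ℂ) * z‖ = ‖z‖ := by
  rcases Int.units_eq_one_or σ with rfl | rfl <;> simp

section Extension

variable {ξ η : ℝ} {a : ℝ → ℝ} {U : Set ℂ} {s : ℂ → ℂ}

theorem norm_s0 (σ : ℤˣ) (x : ℝ) : ‖s0 a σ x‖ = √(a x) := by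
  rw [s0, norm_intUnit_mul, norm_mul, Complex.norm_I, one_mul, Complex.norm_real,
    Real.norm_of_nonneg (Real.sqrt_nonneg _)]

theorem holomorphicExtension_dSpm (hξη : ξ < η)
    (hs : HolomorphicExtension (s0 a 1) (Icc ξ η) s U) (h0 : ∀ z ∈ U, s z ≠ 0) (σ : ℤˣ) (n : ℕ) :
    HolomorphicExtension (dSpm ξ η a σ n) (Icc ξ η) (cdS (fun z => ((σ : ℤ) : ℂ) * s z) n) U := by
  refine HolomorphicExtension.dS hξη ⟨hs.isOpen, hs.mem, hs.differentiableOn.const_mul _, ?_⟩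
    (fun z hz => ?_) n
  · intro x hx
    rw [← hs.eq x hx]
    simp [s0]
  · rw [← norm_pos_iff, norm_intUnit_mul, norm_pos_iff]
    exact h0 z hz

theorem norm_Spm_le {C : ℝ} {σ : ℤˣ} {n : ℕ} (hC : ∀ x ∈ Icc ξ η, ‖dSpm ξ η a σ n x‖ ≤ C)
    {x : ℝ} (hx : x ∈ Icc ξ η) : ‖Spm ξ η a σ n x‖ ≤ (η - ξ) * C := by
  have hC0 : 0 ≤ C := (norm_nonneg _).trans (hC x hx)
  have hbound : ∀ τ ∈ uIoc ξ x, ‖dSpm ξ η a σ n τ‖ ≤ C := by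
    intro τ hτ
    rw [uIoc_of_le hx.1] at hτ
    exact hC τ ⟨hτ.1.le, hτ.2.trans hx.2⟩
  calc ‖Spm ξ η a σ n x‖ ≤ C * |x - ξ| := intervalIntegral.norm_integral_le_of_norm_le_const hbound
    _ ≤ (η - ξ) * C := by
      rw [abs_of_nonneg (sub_nonneg.2 hx.1), mul_comm]
      gcongr
      exact hx.2

theorem seriesBounds_of_norm_cdS_le (hξη : ξ < η) {r M K₂ : ℝ} (hr : 0 < r) (hM : 0 ≤ M)
    (hK₂ : 0 < K₂)
    (hs : HolomorphicExtension (s0 a 1) (Icc ξ η) s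
      (Metric.thickening r (Complex.ofReal '' Icc ξ η)))
    (h0 : ∀ z ∈ Metric.thickening r (Complex.ofReal '' Icc ξ η), s z ≠ 0)
    (hbound : ∀ (σ : ℤˣ) (n : ℕ), ∀ z ∈ Metric.thickening r (Complex.ofReal '' Icc ξ η),
      ‖cdS (fun z => ((σ : ℤ) : ℂ) * s z) n z‖ ≤ M * (K₂ ^ n * (n : ℝ) ^ n)) :
    SeriesBounds ξ η a (ENNReal.ofReal M) (2 / r) K₂ where
  pos₁ := by positivity
  pos₂ := hK₂
  bound σ n := by
    have hext := holomorphicExtension_dSpm hξη hs h0 σ n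
    rw [mul_assoc, ← ENNReal.ofReal_mul hM, ← ENNReal.ofReal_mul (sub_nonneg.2 hξη.le)]
    refine linftyNorm_le_of_forall measurableSet_Icc fun x hx => norm_Spm_le (fun y hy => ?_) hx
    rw [hext.eq y hy]
    exact hbound σ n y (hext.mem y hy)
  bound_deriv σ n k hk := by
    obtain ⟨k, rfl⟩ := Nat.exists_eq_add_of_le' hk
    have hext := holomorphicExtension_dSpm hξη hs h0 σ n
    rw [← ENNReal.ofReal_mul hM, add_tsub_cancel_right]
    refine linftyNorm_le_of_forall measurableSet_Icc fun x hx => ?_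
    have hsub : Metric.closedBall (x : ℂ) (r / 2)
        ⊆ Metric.thickening r (Complex.ofReal '' Icc ξ η) := by
      intro w hw
      rw [Metric.mem_closedBall] at hw
      exact Metric.mem_thickening_iff.2 ⟨x, mem_image_of_mem _ hx, by linarith⟩
    have hcauchy := Complex.norm_iteratedDeriv_le_of_forall_mem_sphere_norm_le k (half_pos hr)
      (hext.differentiableOn.diffContOnCl_ball hsub)
      fun w hw => hbound σ n w (hsub (Metric.sphere_subset_closedBall hw))
    calc ‖iteratedDerivWithin (k + 1) (Spm ξ η a σ n) (Icc ξ η) x‖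
        = ‖iteratedDeriv k (cdS (fun z => ((σ : ℤ) : ℂ) * s z) n) x‖ := by
          rw [← hext.iteratedDerivWithin_succ_integral hξη k hx]
          rfl
      _ ≤ k.factorial * (M * (K₂ ^ n * (n : ℝ) ^ n)) / (r / 2) ^ k := hcauchy
      _ = M * (k.factorial * (2 / r) ^ k * K₂ ^ n * (n : ℝ) ^ n) := by
          rw [div_pow, div_pow]
          field_simp

theorem exists_seriesBounds (hξη : ξ < η) {δ m M : ℝ} (hδ : 0 < δ) (hm : 0 < m)
    (hs : HolomorphicExtension (s0 a 1) (Icc ξ η) s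
      (Metric.thickening δ (Complex.ofReal '' Icc ξ η)))
    (hsm : ∀ z ∈ Metric.thickening δ (Complex.ofReal '' Icc ξ η), m ≤ ‖s z‖)
    (hsM : ∀ z ∈ Metric.thickening δ (Complex.ofReal '' Icc ξ η), ‖s z‖ ≤ M) :
    ∃ K₁ K₂ : ℝ, SeriesBounds ξ η a (ENNReal.ofReal M) K₁ K₂ := by
  set T := Complex.ofReal '' Icc ξ η
  have hmM : m ≤ M := by
    have hξ := hs.mem ξ (left_mem_Icc.2 hξη.le)
    exact (hsm _ hξ).trans (hsM _ hξ)
  have hM : 0 < M := hm.trans_le hmM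
  have hsub : Metric.thickening (δ / 2) T ⊆ Metric.thickening δ T :=
    Metric.thickening_mono (by linarith) T
  have hs_half : HolomorphicExtension (s0 a 1) (Icc ξ η) s (Metric.thickening (δ / 2) T) :=
    hs.mono Metric.isOpen_thickening (fun x hx => Metric.self_subset_thickening (half_pos hδ) T
      (mem_image_of_mem _ hx)) hsub
  refine ⟨_, Real.exp 1 * M / m ^ 2 / (δ / 2), seriesBounds_of_norm_cdS_le hξη (half_pos hδ) hM.le
    (by positivity) hs_half (fun z hz => norm_pos_iff.1 (hm.trans_le (hsm z (hsub hz)))) ?_⟩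
  intro σ n z hz
  rcases n with _ | n
  · simpa only [cdS_zero, norm_intUnit_mul, pow_zero, mul_one] using hsM z (hsub hz)
  · have hnagumo := norm_cdS_succ_le_factorial (s := fun z => ((σ : ℤ) : ℂ) * s z) hm hmM rfl
      (hs.differentiableOn.const_mul _) (by simpa only [norm_intUnit_mul] using hsm)
      (by simpa only [norm_intUnit_mul] using hsM) n (δ / 2) (half_pos hδ) z (by rwa [sub_half])
    refine hnagumo.trans ?_
    rw [mul_assoc]
    gcongr
    exact_mod_cast Nat.factorial_le_pow (n + 1)

end Extension

/-! ### An energy estimate -/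

theorem le_gronwallBound_of_hasDerivWithinAt {f f' : ℝ → ℝ} {δ K c ξ η : ℝ}
    (hf : ∀ x ∈ Icc ξ η, HasDerivWithinAt f (f' x) (Icc ξ η) x) (hδ : f ξ ≤ δ)
    (hbound : ∀ x ∈ Icc ξ η, f' x ≤ K * f x + c) {x : ℝ} (hx : x ∈ Icc ξ η) :
    f x ≤ gronwallBound δ K c (x - ξ) := by
  refine le_gronwallBound_of_liminf_deriv_right_le (fun y hy => (hf y hy).continuousWithinAt)
    (fun y hy r hr => ?_) hδ (fun y hy => hbound y (Ico_subset_Icc_self hy)) x hx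
  have hright : HasDerivWithinAt f (f' y) (Ici y) y :=
    (hf y (Ico_subset_Icc_self hy)).mono_of_mem_nhdsWithin (Icc_mem_nhdsGE_of_mem hy)
  simpa only [slope_def_field, div_eq_inv_mul] using hright.liminf_right_slope_le hr

theorem energy_deriv_le {V : Type*} [NormedAddCommGroup V] [InnerProductSpace ℝ V]
    {ε A a₀ F b b' : ℝ} {e e₁ e₂ : V} (hε : ε ≠ 0) (ha₀ : 0 < a₀) (hb : a₀ ≤ b) (hb' : |b'| ≤ A)
    (hF : ‖ε ^ 2 • e₂ + b • e‖ ≤ F) :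
    b' * ‖e‖ ^ 2 + b * (2 * inner ℝ e e₁) + ε ^ 2 * (2 * inner ℝ e₁ e₂)
      ≤ (A / a₀ + 1) * (b * ‖e‖ ^ 2 + ε ^ 2 * ‖e₁‖ ^ 2) + (F / ε) ^ 2 := by
  have hA : 0 ≤ A := (abs_nonneg b').trans hb'
  have hinner : b * (2 * inner ℝ e e₁) + ε ^ 2 * (2 * inner ℝ e₁ e₂)
      = 2 * inner ℝ e₁ (ε ^ 2 • e₂ + b • e) := by
    rw [inner_add_right, inner_smul_right, inner_smul_right, real_inner_comm e e₁]
    ring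
  have hyoung : 2 * inner ℝ e₁ (ε ^ 2 • e₂ + b • e) ≤ ε ^ 2 * ‖e₁‖ ^ 2 + (F / ε) ^ 2 := by
    calc 2 * inner ℝ e₁ (ε ^ 2 • e₂ + b • e) ≤ 2 * (‖e₁‖ * F) := by
          gcongr
          exact (real_inner_le_norm _ _).trans (by gcongr)
      _ = 2 * (ε * ‖e₁‖) * (F / ε) := by field_simp
      _ ≤ (ε * ‖e₁‖) ^ 2 + (F / ε) ^ 2 := two_mul_le_add_sq _ _
      _ = ε ^ 2 * ‖e₁‖ ^ 2 + (F / ε) ^ 2 := by rw [mul_pow]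
  have hcoeff : b' * ‖e‖ ^ 2 ≤ A / a₀ * (b * ‖e‖ ^ 2) := by
    calc b' * ‖e‖ ^ 2 ≤ A / a₀ * a₀ * ‖e‖ ^ 2 := by
          rw [div_mul_cancel₀ _ ha₀.ne']
          gcongr
          exact (le_abs_self _).trans hb'
      _ ≤ A / a₀ * (b * ‖e‖ ^ 2) := by
          rw [mul_assoc]
          gcongr
  have hpot : 0 ≤ b * ‖e‖ ^ 2 := mul_nonneg (ha₀.le.trans hb) (by positivity)
  have hkin : 0 ≤ A / a₀ * (ε ^ 2 * ‖e₁‖ ^ 2) := by positivity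
  rw [add_assoc, hinner]
  linarith

theorem norm_le_of_norm_oscillator_le {V : Type*} [NormedAddCommGroup V] [InnerProductSpace ℝ V]
    {ξ η ε A a₀ F : ℝ} {a a' : ℝ → ℝ} {E E₁ E₂ : ℝ → V} (hε : 0 < ε) (ha₀ : 0 < a₀)
    (ha : ∀ x ∈ Icc ξ η, a₀ ≤ a x)
    (ha' : ∀ x ∈ Icc ξ η, HasDerivWithinAt a (a' x) (Icc ξ η) x)
    (haA : ∀ x ∈ Icc ξ η, |a' x| ≤ A)
    (hE : ∀ x ∈ Icc ξ η, HasDerivWithinAt E (E₁ x) (Icc ξ η) x)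
    (hE₁ : ∀ x ∈ Icc ξ η, HasDerivWithinAt E₁ (E₂ x) (Icc ξ η) x)
    (hode : ∀ x ∈ Icc ξ η, ‖ε ^ 2 • E₂ x + a x • E x‖ ≤ F)
    (hE0 : E ξ = 0) (hE₁0 : E₁ ξ = 0) {x : ℝ} (hx : x ∈ Icc ξ η) :
    ‖E x‖ ≤ √(Real.exp ((A / a₀ + 1) * (η - ξ)) / a₀) * (F / ε) := by
  have hA : 0 ≤ A := (abs_nonneg _).trans (haA x hx)
  have hF : 0 ≤ F := (norm_nonneg _).trans (hode x hx)
  set K := A / a₀ + 1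
  have hK1 : 1 ≤ K := le_add_of_nonneg_left (by positivity)
  have hgronwall : a x * ‖E x‖ ^ 2 + ε ^ 2 * ‖E₁ x‖ ^ 2
      ≤ gronwallBound 0 K ((F / ε) ^ 2) (x - ξ) :=
    le_gronwallBound_of_hasDerivWithinAt (f := fun y => a y * ‖E y‖ ^ 2 + ε ^ 2 * ‖E₁ y‖ ^ 2)
      (fun y hy => ((ha' y hy).mul (hE y hy).norm_sq).add ((hE₁ y hy).norm_sq.const_mul _))
      (by simp [hE0, hE₁0])
      (fun y hy => energy_deriv_le hε.ne' ha₀ (ha y hy) (haA y hy) (hode y hy)) hx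
  have henergy : a₀ * ‖E x‖ ^ 2 ≤ Real.exp (K * (η - ξ)) * (F / ε) ^ 2 := by
    calc a₀ * ‖E x‖ ^ 2 ≤ a x * ‖E x‖ ^ 2 + ε ^ 2 * ‖E₁ x‖ ^ 2 :=
          le_add_of_le_of_nonneg (by gcongr; exact ha x hx) (by positivity)
      _ ≤ (F / ε) ^ 2 / K * (Real.exp (K * (x - ξ)) - 1) := by
          simpa only [gronwallBound_of_K_ne_0 (zero_lt_one.trans_le hK1).ne', zero_mul, zero_add]
            using hgronwall
      _ ≤ (F / ε) ^ 2 * Real.exp (K * (η - ξ)) := by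
          have hexp : Real.exp (K * (x - ξ)) - 1 ≤ Real.exp (K * (η - ξ)) := by
            have : Real.exp (K * (x - ξ)) ≤ Real.exp (K * (η - ξ)) := by
              gcongr
              exact hx.2
            linarith
          have hnonneg : 0 ≤ Real.exp (K * (x - ξ)) - 1 :=
            sub_nonneg.2 (Real.one_le_exp (mul_nonneg (by positivity) (sub_nonneg.2 hx.1)))
          gcongr
          exact div_le_self (by positivity) hK1
      _ = Real.exp (K * (η - ξ)) * (F / ε) ^ 2 := mul_comm _ _
  refine le_of_sq_le_sq ?_ (by positivity)
  rw [mul_pow, Real.sq_sqrt (by positivity), div_mul_eq_mul_div, le_div_iff₀ ha₀, mul_comm]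
  exact henergy

/-! ### The residual of a truncated formal solution of the Riccati equation -/

section Residual

open Finset.HasAntidiagonal (antidiagonal)

variable {R : Type*} [CommRing R]

theorem sum_range_sq_eq_sum_antidiagonal_add (g : ℕ → R) (N : ℕ) :
    (∑ n ∈ Finset.range (N + 1), g n) ^ 2
      = (∑ m ∈ Finset.range (N + 1), ∑ p ∈ antidiagonal m, g p.1 * g p.2)
        + ∑ p ∈ Finset.range (N + 1) ×ˢ Finset.range (N + 1) with N < p.1 + p.2,
            g p.1 * g p.2 := by
  have hdiag : ∀ m ∈ Finset.range (N + 1),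
      {p ∈ {p ∈ Finset.range (N + 1) ×ˢ Finset.range (N + 1) | ¬ N < p.1 + p.2} | p.1 + p.2 = m}
        = antidiagonal m := by
    intro m hm
    ext p
    simp only [Finset.mem_filter, Finset.mem_product, Finset.mem_range,
      Finset.HasAntidiagonal.mem_antidiagonal]
      at hm ⊢
    omega
  rw [sq, Finset.sum_mul_sum, ← Finset.sum_product',
    ← Finset.sum_filter_add_sum_filter_not _ (fun p : ℕ × ℕ => N < p.1 + p.2), add_comm]
  congr 1
  rw [← Finset.sum_fiberwise_of_maps_to (t := Finset.range (N + 1)) (g := fun p => p.1 + p.2)]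
  · exact Finset.sum_congr rfl fun m hm => by rw [hdiag m hm]
  · intro p hp
    simp only [Finset.mem_filter] at hp
    exact Finset.mem_range.2 (by omega)

theorem riccati_residual_eq {f d : ℕ → R} {a : R} (ε : R) (h0 : f 0 ^ 2 = -a)
    (hf : ∀ n, ∑ p ∈ antidiagonal (n + 1), f p.1 * f p.2 = -d n) (N : ℕ) :
    (∑ n ∈ Finset.range (N + 1), ε ^ n * f n) ^ 2
        + ε * (∑ n ∈ Finset.range (N + 1), ε ^ n * d n) + a
      = ε ^ (N + 1) * d N
        + ∑ p ∈ Finset.range (N + 1) ×ˢ Finset.range (N + 1) with N < p.1 + p.2,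
            (ε ^ p.1 * f p.1) * (ε ^ p.2 * f p.2) := by
  have hdiag : ∀ n, ∑ p ∈ antidiagonal n, (ε ^ p.1 * f p.1) * (ε ^ p.2 * f p.2)
      = ε ^ n * ∑ p ∈ antidiagonal n, f p.1 * f p.2 := by
    intro n
    rw [Finset.mul_sum]
    refine Finset.sum_congr rfl fun p hp => ?_
    rw [← Finset.HasAntidiagonal.mem_antidiagonal.1 hp, pow_add]
    ring
  have hsucc : ∑ n ∈ Finset.range N, ε ^ (n + 1) * -d n
      = -(ε * ∑ n ∈ Finset.range N, ε ^ n * d n) := by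
    rw [Finset.mul_sum, ← Finset.sum_neg_distrib]
    exact Finset.sum_congr rfl fun n _ => by ring
  rw [sum_range_sq_eq_sum_antidiagonal_add]
  simp only [hdiag]
  rw [Finset.sum_range_succ']
  simp only [hf, hsucc, Finset.Nat.antidiagonal_zero, Finset.sum_singleton, pow_zero, one_mul]
  rw [Finset.sum_range_succ]
  linear_combination h0

theorem sum_antidiagonal_dS {ξ η : ℝ} {s : ℝ → ℂ} {x : ℝ} (hx : s x ≠ 0) (n : ℕ) :
    ∑ p ∈ antidiagonal (n + 1), dS ξ η s p.1 x * dS ξ η s p.2 x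
      = -derivWithin (dS ξ η s n) (Icc ξ η) x := by
  have hrec : 2 * s x * dS ξ η s (n + 1) x
      = -((∑ j ∈ Finset.Icc 1 n, dS ξ η s j x * dS ξ η s (n + 1 - j) x)
        + derivWithin (dS ξ η s n) (Icc ξ η) x) := by
    rw [dS_succ]
    field_simp
  rw [Finset.Nat.sum_antidiagonal_eq_sum_range_succ (fun j k => dS ξ η s j x * dS ξ η s k x),
    Finset.sum_range_succ, Finset.sum_range_succ', Finset.range_eq_Ico,
    Finset.sum_Ico_add' (fun j => dS ξ η s j x * dS ξ η s (n + 1 - j) x) 0 n 1,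
    show Finset.Ico (0 + 1) (n + 1) = Finset.Icc 1 n by ext; simp, Nat.sub_self, Nat.sub_zero,
    dS_zero]
  linear_combination hrec

end Residual

/-! ### The WKB approximation as an approximate solution -/

section Approximation

variable {ξ η : ℝ} {a : ℝ → ℝ}

/-- The truncated series `∑_{n=0}^N ε^n (S_n^±)'(x)`, i.e. `ε` times the derivative of the
exponent of a WKB branch. It approximately solves the Riccati equation `u² + ε u' + a = 0`. -/
def slope (ξ η : ℝ) (a : ℝ → ℝ) (ε : ℝ) (N : ℕ) (σ : ℤˣ) (x : ℝ) : ℂ :=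
  ∑ n ∈ Finset.range (N + 1), (ε : ℂ) ^ n * dSpm ξ η a σ n x

/-- The residual of `slope` in the Riccati equation `u² + ε u' + a = 0`. -/
def riccatiResidual (ξ η : ℝ) (a : ℝ → ℝ) (ε : ℝ) (N : ℕ) (σ : ℤˣ) (x : ℝ) : ℂ :=
  slope ξ η a ε N σ x ^ 2 + ε * derivWithin (slope ξ η a ε N σ) (Icc ξ η) x + a x

/-- The function `ε (φ_N^{WKB})'`, in closed form. -/
def phiWKBSlope (ξ η : ℝ) (a : ℝ → ℝ) (ε : ℝ) (φ₀ φ₁ : ℂ) (N : ℕ) (x : ℝ) : ℂ :=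
  alpha ξ η a ε φ₀ φ₁ N * (slope ξ η a ε N (-1) x * Complex.exp (expo ξ η a ε N (-1) x))
    + beta ξ η a ε φ₀ φ₁ N * (slope ξ η a ε N 1 x * Complex.exp (expo ξ η a ε N 1 x))

/-- The residual of `φ_N^{WKB}` in the equation `ε² φ'' + a φ = 0`. -/
def phiWKBResidual (ξ η : ℝ) (a : ℝ → ℝ) (ε : ℝ) (φ₀ φ₁ : ℂ) (N : ℕ) (x : ℝ) : ℂ :=
  alpha ξ η a ε φ₀ φ₁ N
      * (riccatiResidual ξ η a ε N (-1) x * Complex.exp (expo ξ η a ε N (-1) x))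
    + beta ξ η a ε φ₀ φ₁ N
      * (riccatiResidual ξ η a ε N 1 x * Complex.exp (expo ξ η a ε N 1 x))

theorem expo_left (ε : ℝ) (N : ℕ) (σ : ℤˣ) : expo ξ η a ε N σ ξ = 0 := by
  simp [expo, Spm]

theorem denom_eq (ε : ℝ) (N : ℕ) :
    denom ξ η a ε N = slope ξ η a ε N 1 ξ - slope ξ η a ε N (-1) ξ := by
  simp only [denom, slope, mul_sub, Finset.sum_sub_distrib]

theorem phiWKB_left {ε : ℝ} {N : ℕ} (φ₀ φ₁ : ℂ) (hD : denom ξ η a ε N ≠ 0) :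
    phiWKB ξ η a ε φ₀ φ₁ N ξ = φ₀ := by
  simp only [phiWKB, expo_left, Complex.exp_zero, mul_one, alpha, beta, slopeSum]
  rw [← add_div, div_eq_iff hD, denom_eq, slope, slope]
  ring

theorem phiWKBSlope_left {ε : ℝ} {N : ℕ} (φ₀ φ₁ : ℂ) (hD : denom ξ η a ε N ≠ 0) :
    phiWKBSlope ξ η a ε φ₀ φ₁ N ξ = φ₁ := by
  simp only [phiWKBSlope, expo_left, Complex.exp_zero, mul_one, alpha, beta, slopeSum]
  rw [div_mul_eq_mul_div, div_mul_eq_mul_div, ← add_div, div_eq_iff hD, denom_eq, slope, slope]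
  ring

theorem norm_alpha_le {ε R B d : ℝ} {N : ℕ} {φ₀ φ₁ : ℂ} (h₀ : ‖φ₀‖ ≤ R) (h₁ : ‖φ₁‖ ≤ R)
    (hB : ‖slope ξ η a ε N 1 ξ‖ ≤ B) (hd : 0 < d) (hD : d ≤ ‖denom ξ η a ε N‖) :
    ‖alpha ξ η a ε φ₀ φ₁ N‖ ≤ R * (B + 1) / d := by
  have hR : 0 ≤ R := (norm_nonneg _).trans h₀
  have hB0 : 0 ≤ B := (norm_nonneg _).trans hB
  rw [alpha, norm_div]
  gcongr
  calc ‖φ₀ * slope ξ η a ε N 1 ξ - φ₁‖ ≤ ‖φ₀‖ * ‖slope ξ η a ε N 1 ξ‖ + ‖φ₁‖ := by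
        rw [← norm_mul]
        exact norm_sub_le _ _
    _ ≤ R * B + R := by gcongr
    _ = R * (B + 1) := by ring

theorem norm_beta_le {ε R B d : ℝ} {N : ℕ} {φ₀ φ₁ : ℂ} (h₀ : ‖φ₀‖ ≤ R) (h₁ : ‖φ₁‖ ≤ R)
    (hB : ‖slope ξ η a ε N (-1) ξ‖ ≤ B) (hd : 0 < d) (hD : d ≤ ‖denom ξ η a ε N‖) :
    ‖beta ξ η a ε φ₀ φ₁ N‖ ≤ R * (B + 1) / d := by
  have hR : 0 ≤ R := (norm_nonneg _).trans h₀
  have hB0 : 0 ≤ B := (norm_nonneg _).trans hB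
  rw [beta, norm_div]
  gcongr
  calc ‖φ₁ - φ₀ * slope ξ η a ε N (-1) ξ‖ ≤ ‖φ₁‖ + ‖φ₀‖ * ‖slope ξ η a ε N (-1) ξ‖ := by
        rw [← norm_mul]
        exact norm_sub_le _ _
    _ ≤ R + R * B := by gcongr
    _ = R * (B + 1) := by ring

theorem hasDerivWithinAt_exp_expo {ε : ℝ} (hε : ε ≠ 0) {N : ℕ} {σ : ℤˣ}
    (hS : ∀ n, ContinuousOn (dSpm ξ η a σ n) (Icc ξ η)) {x : ℝ} (hx : x ∈ Icc ξ η) :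
    HasDerivWithinAt (fun y => Complex.exp (expo ξ η a ε N σ y))
      ((ε : ℂ)⁻¹ * (slope ξ η a ε N σ x * Complex.exp (expo ξ η a ε N σ x))) (Icc ξ η) x := by
  have hexpo : HasDerivWithinAt (expo ξ η a ε N σ)
      (∑ n ∈ Finset.range (N + 1), (ε : ℂ) ^ ((n : ℤ) - 1) * dSpm ξ η a σ n x) (Icc ξ η) x :=
    HasDerivWithinAt.fun_sum fun n _ => (hasDerivWithinAt_integral_Icc (hS n) hx).const_mul _
  have hslope : ∑ n ∈ Finset.range (N + 1), (ε : ℂ) ^ ((n : ℤ) - 1) * dSpm ξ η a σ n x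
      = (ε : ℂ)⁻¹ * slope ξ η a ε N σ x := by
    rw [slope, Finset.mul_sum]
    refine Finset.sum_congr rfl fun n _ => ?_
    rw [zpow_sub_one₀ (Complex.ofReal_ne_zero.2 hε), zpow_natCast]
    ring
  refine hexpo.cexp.congr_deriv ?_
  rw [hslope]
  ring

theorem hasDerivWithinAt_slope_mul_exp_expo {ε : ℝ} (hε : ε ≠ 0) {N : ℕ} {σ : ℤˣ}
    (hS : ∀ n, DifferentiableOn ℝ (dSpm ξ η a σ n) (Icc ξ η)) {x : ℝ} (hx : x ∈ Icc ξ η) :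
    HasDerivWithinAt (fun y => slope ξ η a ε N σ y * Complex.exp (expo ξ η a ε N σ y))
      ((ε : ℂ)⁻¹ * ((riccatiResidual ξ η a ε N σ x - a x) * Complex.exp (expo ξ η a ε N σ x)))
      (Icc ξ η) x := by
  have hεc : (ε : ℂ) ≠ 0 := Complex.ofReal_ne_zero.2 hε
  have hslope : DifferentiableWithinAt ℝ (slope ξ η a ε N σ) (Icc ξ η) x :=
    DifferentiableWithinAt.fun_sum fun n _ => (hS n x hx).const_mul _
  refine (hslope.hasDerivWithinAt.mul
    (hasDerivWithinAt_exp_expo hε (fun n => (hS n).continuousOn) hx)).congr_deriv ?_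
  rw [riccatiResidual]
  field_simp
  ring

theorem hasDerivWithinAt_phiWKB {ε : ℝ} (hε : ε ≠ 0) (φ₀ φ₁ : ℂ) (N : ℕ)
    (hS : ∀ σ n, ContinuousOn (dSpm ξ η a σ n) (Icc ξ η)) {x : ℝ} (hx : x ∈ Icc ξ η) :
    HasDerivWithinAt (phiWKB ξ η a ε φ₀ φ₁ N) ((ε : ℂ)⁻¹ * phiWKBSlope ξ η a ε φ₀ φ₁ N x)
      (Icc ξ η) x := by
  refine (((hasDerivWithinAt_exp_expo hε (hS (-1)) hx).const_mul _).add
    ((hasDerivWithinAt_exp_expo hε (hS 1) hx).const_mul _)).congr_deriv ?_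
  rw [phiWKBSlope]
  ring

theorem hasDerivWithinAt_phiWKBSlope {ε : ℝ} (hε : ε ≠ 0) (φ₀ φ₁ : ℂ) (N : ℕ)
    (hS : ∀ σ n, DifferentiableOn ℝ (dSpm ξ η a σ n) (Icc ξ η)) {x : ℝ} (hx : x ∈ Icc ξ η) :
    HasDerivWithinAt (phiWKBSlope ξ η a ε φ₀ φ₁ N)
      ((ε : ℂ)⁻¹ * (phiWKBResidual ξ η a ε φ₀ φ₁ N x - a x * phiWKB ξ η a ε φ₀ φ₁ N x))
      (Icc ξ η) x := by
  refine (((hasDerivWithinAt_slope_mul_exp_expo hε (hS (-1)) hx).const_mul _).add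
    ((hasDerivWithinAt_slope_mul_exp_expo hε (hS 1) hx).const_mul _)).congr_deriv ?_
  rw [phiWKBResidual, phiWKB]
  ring

theorem norm_phiWKBResidual_le {ε Γ W ρ : ℝ} {N : ℕ} {φ₀ φ₁ : ℂ} {x : ℝ}
    (hα : ‖alpha ξ η a ε φ₀ φ₁ N‖ ≤ Γ) (hβ : ‖beta ξ η a ε φ₀ φ₁ N‖ ≤ Γ)
    (hρ : ∀ σ, ‖riccatiResidual ξ η a ε N σ x‖ ≤ ρ)
    (hW : ∀ σ, ‖Complex.exp (expo ξ η a ε N σ x)‖ ≤ W) :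
    ‖phiWKBResidual ξ η a ε φ₀ φ₁ N x‖ ≤ 2 * (Γ * (ρ * W)) := by
  have hΓ : 0 ≤ Γ := (norm_nonneg _).trans hα
  have hρ0 : 0 ≤ ρ := (norm_nonneg _).trans (hρ 1)
  rw [two_mul]
  refine norm_add_le_of_le ?_ ?_ <;> rw [norm_mul, norm_mul] <;> gcongr <;>
    first | exact hρ _ | exact hW _

theorem norm_sub_phiWKB_le {ε a₀ A F : ℝ} {a' : ℝ → ℝ} {N : ℕ} {φ₀ φ₁ : ℂ} {φ : ℝ → ℂ}
    (hξη : ξ < η) (hε : 0 < ε) (ha₀ : 0 < a₀) (ha : ∀ x ∈ Icc ξ η, a₀ ≤ a x)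
    (ha' : ∀ x ∈ Icc ξ η, HasDerivWithinAt a (a' x) (Icc ξ η) x)
    (haA : ∀ x ∈ Icc ξ η, |a' x| ≤ A)
    (hS : ∀ σ n, DifferentiableOn ℝ (dSpm ξ η a σ n) (Icc ξ η)) (hD : denom ξ η a ε N ≠ 0)
    (hF : ∀ x ∈ Icc ξ η, ‖phiWKBResidual ξ η a ε φ₀ φ₁ N x‖ ≤ F)
    (hφ : IsSolution ξ η a ε φ₀ φ₁ φ) {x : ℝ} (hx : x ∈ Icc ξ η) :
    ‖φ x - phiWKB ξ η a ε φ₀ φ₁ N x‖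
      ≤ √(Real.exp ((A / a₀ + 1) * (η - ξ)) / a₀) * (F / ε) := by
  have hε0 := hε.ne'
  have hεc : (ε : ℂ) ≠ 0 := Complex.ofReal_ne_zero.2 hε0
  have hφ' : ∀ y ∈ Icc ξ η,
      HasDerivWithinAt φ (derivWithin φ (Icc ξ η) y) (Icc ξ η) y := fun y hy =>
    (hφ.contDiffOn.differentiableOn two_ne_zero y hy).hasDerivWithinAt
  have hφ'' : ∀ y ∈ Icc ξ η, HasDerivWithinAt (derivWithin φ (Icc ξ η))
      (iteratedDerivWithin 2 φ (Icc ξ η) y) (Icc ξ η) y := by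
    intro y hy
    rw [iteratedDerivWithin_succ, iteratedDerivWithin_one]
    exact ((hφ.contDiffOn.derivWithin (uniqueDiffOn_Icc hξη) (by norm_num)).differentiableOn
      one_ne_zero y hy).hasDerivWithinAt
  refine norm_le_of_norm_oscillator_le hε ha₀ ha ha' haA
    (E := fun y => φ y - phiWKB ξ η a ε φ₀ φ₁ N y)
    (E₁ := fun y => derivWithin φ (Icc ξ η) y - (ε : ℂ)⁻¹ * phiWKBSlope ξ η a ε φ₀ φ₁ N y)
    (fun y hy => (hφ' y hy).sub
      (hasDerivWithinAt_phiWKB hε0 φ₀ φ₁ N (fun σ n => (hS σ n).continuousOn) hy))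
    (fun y hy => (hφ'' y hy).sub
      ((hasDerivWithinAt_phiWKBSlope hε0 φ₀ φ₁ N hS hy).const_mul _))
    (fun y hy => ?_) ?_ ?_ hx
  · refine le_of_eq_of_le ?_ (hF y hy)
    rw [← norm_neg (phiWKBResidual ξ η a ε φ₀ φ₁ N y), Complex.real_smul, Complex.real_smul]
    congr 1
    push_cast
    field_simp
    linear_combination hφ.ode y hy
  · rw [hφ.init, phiWKB_left φ₀ φ₁ hD, sub_self]
  · rw [phiWKBSlope_left φ₀ φ₁ hD, ← hφ.init_deriv, inv_mul_cancel_left₀ hεc, sub_self]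

end Approximation

/-! ### Pointwise bounds and truncated sums -/

/-- The bounds on `S_n`, `S_n'` and `S_n''` contained in `SeriesBounds`, in pointwise form. -/
structure PointwiseBounds (ξ η : ℝ) (a : ℝ → ℝ) (M K₁ K₂ : ℝ) : Prop where
  lt : ξ < η
  M_nonneg : 0 ≤ M
  K₁_pos : 0 < K₁
  K₂_pos : 0 < K₂
  contDiffOn : ∀ σ n, ContDiffOn ℝ 1 (dSpm ξ η a σ n) (Icc ξ η)
  norm_Spm_le : ∀ σ n, ∀ x ∈ Icc ξ η, ‖Spm ξ η a σ n x‖ ≤ (η - ξ) * M * (K₂ ^ n * (n : ℝ) ^ n)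
  norm_dSpm_le : ∀ σ n, ∀ x ∈ Icc ξ η, ‖dSpm ξ η a σ n x‖ ≤ M * (K₂ ^ n * (n : ℝ) ^ n)
  norm_derivWithin_dSpm_le : ∀ σ n, ∀ x ∈ Icc ξ η,
    ‖derivWithin (dSpm ξ η a σ n) (Icc ξ η) x‖ ≤ M * K₁ * (K₂ ^ n * (n : ℝ) ^ n)

section Pointwise

variable {ξ η : ℝ} {a : ℝ → ℝ} {M K₁ K₂ : ℝ}

theorem SeriesBounds.norm_iteratedDerivWithin_Spm_le
    (h : SeriesBounds ξ η a (ENNReal.ofReal M) K₁ K₂) (hξη : ξ < η) (hM : 0 ≤ M) {σ : ℤˣ}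
    {n k : ℕ} {f : ℝ → ℂ} (hf : ContinuousOn f (Icc ξ η))
    (hSf : EqOn (iteratedDerivWithin (k + 1) (Spm ξ η a σ n) (Icc ξ η)) f (Icc ξ η))
    {x : ℝ} (hx : x ∈ Icc ξ η) :
    ‖f x‖ ≤ M * (k.factorial * K₁ ^ k * K₂ ^ n * (n : ℝ) ^ n) := by
  have h1 := h.pos₁
  have h2 := h.pos₂
  rw [← hSf hx]
  refine norm_le_of_linftyNorm_le (closure_interior_Icc hξη.ne).ge (hf.congr hSf)
    (by positivity) ?_ x hx
  rw [ENNReal.ofReal_mul hM]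
  exact h.bound_deriv σ n (k + 1) k.succ_pos

theorem SeriesBounds.pointwiseBounds (h : SeriesBounds ξ η a (ENNReal.ofReal M) K₁ K₂)
    (hξη : ξ < η) (hM : 0 ≤ M) (hS : ∀ σ n, ContDiffOn ℝ 1 (dSpm ξ η a σ n) (Icc ξ η)) :
    PointwiseBounds ξ η a M K₁ K₂ := by
  have h2 := h.pos₂
  have hu := uniqueDiffOn_Icc hξη
  have hderiv : ∀ σ n, ∀ x ∈ Icc ξ η,
      HasDerivWithinAt (Spm ξ η a σ n) (dSpm ξ η a σ n x) (Icc ξ η) x := fun σ n x hx =>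
    hasDerivWithinAt_integral_Icc (hS σ n).continuousOn hx
  have hderiv₁ : ∀ σ n, EqOn (iteratedDerivWithin 1 (Spm ξ η a σ n) (Icc ξ η))
      (dSpm ξ η a σ n) (Icc ξ η) := fun σ n x hx => by
    rw [iteratedDerivWithin_one, (hderiv σ n x hx).derivWithin (hu x hx)]
  have hderiv₂ : ∀ σ n, EqOn (iteratedDerivWithin 2 (Spm ξ η a σ n) (Icc ξ η))
      (derivWithin (dSpm ξ η a σ n) (Icc ξ η)) (Icc ξ η) := fun σ n x hx => by
    rw [iteratedDerivWithin_succ]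
    exact derivWithin_congr (hderiv₁ σ n) (hderiv₁ σ n hx)
  refine ⟨hξη, hM, h.pos₁, h2, hS, fun σ n => ?_, fun σ n x hx => ?_, fun σ n x hx => ?_⟩
  · have hl : 0 ≤ η - ξ := sub_nonneg.2 hξη.le
    refine norm_le_of_linftyNorm_le (closure_interior_Icc hξη.ne).ge
      (fun x hx => (hderiv σ n x hx).continuousWithinAt) (by positivity) ?_
    rw [ENNReal.ofReal_mul (by positivity), ENNReal.ofReal_mul hl]
    exact h.bound σ n
  · simpa using h.norm_iteratedDerivWithin_Spm_le hξη hM (hS σ n).continuousOn (hderiv₁ σ n) hx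
  · simpa [mul_assoc] using h.norm_iteratedDerivWithin_Spm_le hξη hM
      ((hS σ n).continuousOn_derivWithin hu le_rfl) (hderiv₂ σ n) hx

end Pointwise

/-- The order `N` is so small that `(t (n + 1)) ^ n` is dominated by the geometric sequence
`q ^ n` for `n < N`. With `t = ε K₂`, the factorially growing terms `(ε K₂ n) ^ n` of the WKB
series are then summable up to order `N`, uniformly in `N`. -/
def IsGeometricTruncation (t q : ℝ) (N : ℕ) : Prop :=
  ∀ n < N, (t * (n + 1 : ℕ)) ^ n ≤ q ^ n

theorem isGeometricTruncation_of_mul_le {t q : ℝ} {N : ℕ} (ht : 0 ≤ t) (hN : t * N ≤ q) :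
    IsGeometricTruncation t q N := fun n hn => by
  gcongr
  exact (mul_le_mul_of_nonneg_left (by exact_mod_cast hn) ht).trans hN

theorem isGeometricTruncation_one (t q : ℝ) : IsGeometricTruncation t q 1 := fun n hn => by
  simp [Nat.lt_one_iff.1 hn]

theorem sum_succ_mul_pow_le {q : ℝ} (hq : 0 ≤ q) (hq1 : q < 1) (N : ℕ) :
    ∑ n ∈ Finset.range N, ((n + 1 : ℕ) : ℝ) * q ^ n ≤ 1 / (1 - q) ^ 2 := by
  have hsum := hasSum_choose_mul_geometric_of_norm_lt_one 1
    (show ‖q‖ < 1 by rwa [Real.norm_of_nonneg hq])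
  simp only [Nat.choose_one_right] at hsum
  exact sum_le_hasSum _ (fun n _ => by positivity) hsum

namespace IsGeometricTruncation

variable {ε K q C : ℝ} {N : ℕ} {f : ℕ → ℂ}

theorem norm_pow_mul_le (h : IsGeometricTruncation (ε * K) q N) (hε : 0 ≤ ε) (hK : 0 ≤ K)
    (hC : 0 ≤ C) (hf : ∀ n, ‖f n‖ ≤ C * (K ^ n * (n : ℝ) ^ n)) {n : ℕ} (hn : n < N) :
    ‖(ε : ℂ) ^ n * f (n + 1)‖ ≤ C * K * ((n + 1 : ℕ) * q ^ n) := by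
  rw [norm_mul, norm_pow, Complex.norm_real, Real.norm_of_nonneg hε]
  calc ε ^ n * ‖f (n + 1)‖ ≤ ε ^ n * (C * (K ^ (n + 1) * ((n + 1 : ℕ) : ℝ) ^ (n + 1))) := by
        gcongr
        exact hf (n + 1)
    _ = C * K * ((n + 1 : ℕ) * (ε * K * (n + 1 : ℕ)) ^ n) := by
        rw [mul_pow, mul_pow]
        ring
    _ ≤ C * K * ((n + 1 : ℕ) * q ^ n) := by
        gcongr C * K * (_ * ?_)
        exact h n hn

theorem norm_sum_pow_mul_le (h : IsGeometricTruncation (ε * K) q N) (hε : 0 ≤ ε) (hK : 0 ≤ K)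
    (hC : 0 ≤ C) (hq : 0 ≤ q) (hq1 : q < 1) (hf : ∀ n, ‖f n‖ ≤ C * (K ^ n * (n : ℝ) ^ n)) :
    ‖∑ n ∈ Finset.range N, (ε : ℂ) ^ n * f (n + 1)‖ ≤ C * K * (1 / (1 - q) ^ 2) := by
  calc ‖∑ n ∈ Finset.range N, (ε : ℂ) ^ n * f (n + 1)‖
      ≤ ∑ n ∈ Finset.range N, C * K * ((n + 1 : ℕ) * q ^ n) :=
        norm_sum_le_of_le _ fun n hn =>
          h.norm_pow_mul_le hε hK hC hf (Finset.mem_range.1 hn)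
    _ ≤ C * K * (1 / (1 - q) ^ 2) := by
        rw [← Finset.mul_sum]
        gcongr
        exact sum_succ_mul_pow_le hq hq1 N

theorem norm_pow_mul_le_of_mem_Icc (h : IsGeometricTruncation (ε * K) q N) (hε : 0 ≤ ε)
    (hK : 0 ≤ K) (hC : 0 ≤ C) (hq : 0 ≤ q) (hf : ∀ n, ‖f n‖ ≤ C * (K ^ n * (n : ℝ) ^ n)) {n : ℕ}
    (hn : n ∈ Finset.Icc 1 N) :
    ‖(ε : ℂ) ^ n * f n‖ ≤ C * K * (ε * N) * q ^ (n - 1) := by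
  obtain ⟨m, rfl⟩ := Nat.exists_eq_add_of_le' (Finset.mem_Icc.1 hn).1
  have hmN : m + 1 ≤ N := (Finset.mem_Icc.1 hn).2
  calc ‖(ε : ℂ) ^ (m + 1) * f (m + 1)‖ = ε * ‖(ε : ℂ) ^ m * f (m + 1)‖ := by
        rw [pow_succ', mul_assoc, norm_mul, Complex.norm_real, Real.norm_of_nonneg hε]
    _ ≤ ε * (C * K * (N * q ^ m)) := by
        gcongr
        exact (h.norm_pow_mul_le hε hK hC hf hmN).trans (by gcongr)
    _ = C * K * (ε * N) * q ^ (m + 1 - 1) := by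
        rw [Nat.add_sub_cancel]
        ring

theorem norm_sum_pairs_le (h : IsGeometricTruncation (ε * K) q N) (hε : 0 ≤ ε)
    (hK : 0 ≤ K) (hC : 0 ≤ C) (hq : 0 ≤ q) (hq1 : q ≤ 1)
    (hf : ∀ n, ‖f n‖ ≤ C * (K ^ n * (n : ℝ) ^ n)) :
    ‖∑ p ∈ Finset.range (N + 1) ×ˢ Finset.range (N + 1) with N < p.1 + p.2,
        ((ε : ℂ) ^ p.1 * f p.1) * ((ε : ℂ) ^ p.2 * f p.2)‖
      ≤ (C * K) ^ 2 * (ε ^ 2 * (N ^ 4 * q ^ (N - 1))) := by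
  set P := {p ∈ Finset.range (N + 1) ×ˢ Finset.range (N + 1) | N < p.1 + p.2}
  have hP : P ⊆ Finset.Icc 1 N ×ˢ Finset.Icc 1 N := fun p hp => by
    simp only [P, Finset.mem_filter, Finset.mem_product, Finset.mem_range, Finset.mem_Icc] at hp ⊢
    omega
  have hcard : (P.card : ℝ) ≤ N ^ 2 := by
    have := Finset.card_le_card hP
    rw [Finset.card_product, Nat.card_Icc, Nat.add_sub_cancel, ← sq] at this
    exact_mod_cast this
  have hterm : ∀ p ∈ P, ‖((ε : ℂ) ^ p.1 * f p.1) * ((ε : ℂ) ^ p.2 * f p.2)‖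
      ≤ (C * K * (ε * N)) ^ 2 * q ^ (N - 1) := fun p hp => by
    obtain ⟨hp₁, hp₂⟩ := Finset.mem_product.1 (hP hp)
    have hsum : N - 1 ≤ (p.1 - 1) + (p.2 - 1) := by
      simp only [P, Finset.mem_filter, Finset.mem_Icc] at hp hp₁ hp₂
      omega
    calc ‖((ε : ℂ) ^ p.1 * f p.1) * ((ε : ℂ) ^ p.2 * f p.2)‖
        ≤ (C * K * (ε * N) * q ^ (p.1 - 1)) * (C * K * (ε * N) * q ^ (p.2 - 1)) := by
          rw [norm_mul]
          gcongr
          · exact h.norm_pow_mul_le_of_mem_Icc hε hK hC hq hf hp₁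
          · exact h.norm_pow_mul_le_of_mem_Icc hε hK hC hq hf hp₂
      _ = (C * K * (ε * N)) ^ 2 * q ^ ((p.1 - 1) + (p.2 - 1)) := by ring
      _ ≤ (C * K * (ε * N)) ^ 2 * q ^ (N - 1) := by
          gcongr ?_ * ?_
          exact pow_le_pow_of_le_one hq hq1 hsum
  calc _ ≤ P.card * ((C * K * (ε * N)) ^ 2 * q ^ (N - 1)) := by
        rw [← nsmul_eq_mul]
        exact (norm_sum_le_of_le _ hterm).trans_eq (Finset.sum_const _)
    _ ≤ N ^ 2 * ((C * K * (ε * N)) ^ 2 * q ^ (N - 1)) := by gcongr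
    _ = (C * K) ^ 2 * (ε ^ 2 * (N ^ 4 * q ^ (N - 1))) := by ring

end IsGeometricTruncation

/-! ### Bounds on the ingredients of the WKB approximation -/

section Ingredients

variable {ξ η : ℝ} {a : ℝ → ℝ} {M K₁ K₂ ε q : ℝ} {N : ℕ}

theorem s0_neg_one (x : ℝ) : s0 a (-1) x = -s0 a 1 x := by
  simp [s0]

theorem s0_sq {x : ℝ} (hx : 0 ≤ a x) (σ : ℤˣ) : s0 a σ x ^ 2 = -(a x : ℂ) := by
  have hσ : ((σ : ℤ) : ℂ) ^ 2 = 1 := by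
    rcases Int.units_eq_one_or σ with rfl | rfl <;> simp
  rw [s0, mul_pow, mul_pow, hσ, Complex.I_sq, ← Complex.ofReal_pow, Real.sq_sqrt hx]
  ring

theorem dSpm_neg_one_one (x : ℝ) : dSpm ξ η a (-1) 1 x = dSpm ξ η a 1 1 x := by
  have hneg : s0 a (-1) = fun x => -s0 a 1 x := funext s0_neg_one
  simp only [dSpm, dS_succ, dS_zero, hneg, derivWithin.fun_neg]
  simp

theorem denom_one (ε : ℝ) : denom ξ η a ε 1 = 2 * s0 a 1 ξ := by
  simp only [denom, Finset.sum_range_succ, Finset.range_zero, Finset.sum_empty, dSpm_neg_one_one,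
    sub_self, mul_zero, add_zero, zero_add, pow_zero, one_mul]
  simp only [dSpm, dS_zero, s0_neg_one]
  ring

theorem Spm_zero_re (σ : ℤˣ) (x : ℝ) : (Spm ξ η a σ 0 x).re = 0 := by
  simp only [Spm, dSpm, dS_zero, s0]
  rw [intervalIntegral.integral_const_mul, intervalIntegral.integral_const_mul,
    intervalIntegral.integral_ofReal]
  rcases Int.units_eq_one_or σ with rfl | rfl <;> simp

theorem contDiffOn_of_contDiffOn_s0 {D : Set ℝ} {n : WithTop ℕ∞}
    (ha : ∀ x ∈ D, 0 ≤ a x) {σ : ℤˣ} (hs : ContDiffOn ℝ n (s0 a σ) D) : ContDiffOn ℝ n a D :=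
  (Complex.reCLM.contDiff.comp_contDiffOn (hs.pow 2).neg).congr fun x hx => by
    simp [s0_sq (ha x hx)]

theorem derivWithin_slope (hξη : ξ < η) {σ : ℤˣ}
    (hS : ∀ n, DifferentiableOn ℝ (dSpm ξ η a σ n) (Icc ξ η)) {x : ℝ} (hx : x ∈ Icc ξ η) :
    derivWithin (slope ξ η a ε N σ) (Icc ξ η) x
      = ∑ n ∈ Finset.range (N + 1), (ε : ℂ) ^ n * derivWithin (dSpm ξ η a σ n) (Icc ξ η) x :=
  (HasDerivWithinAt.fun_sum fun n _ => ((hS n x hx).hasDerivWithinAt).const_mul _).derivWithin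
    (uniqueDiffOn_Icc hξη x hx)

theorem riccatiResidual_eq (hξη : ξ < η) {σ : ℤˣ}
    (hS : ∀ n, DifferentiableOn ℝ (dSpm ξ η a σ n) (Icc ξ η)) {x : ℝ} (hx : x ∈ Icc ξ η)
    (hax : 0 < a x) :
    riccatiResidual ξ η a ε N σ x
      = (ε : ℂ) ^ (N + 1) * derivWithin (dSpm ξ η a σ N) (Icc ξ η) x
        + ∑ p ∈ Finset.range (N + 1) ×ˢ Finset.range (N + 1) with N < p.1 + p.2,
            ((ε : ℂ) ^ p.1 * dSpm ξ η a σ p.1 x) * ((ε : ℂ) ^ p.2 * dSpm ξ η a σ p.2 x) := by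
  have hs0 : s0 a σ x ≠ 0 := by
    rw [← norm_pos_iff, norm_s0]
    exact Real.sqrt_pos.2 hax
  rw [riccatiResidual, derivWithin_slope hξη hS hx, slope]
  exact riccati_residual_eq (f := fun n => dSpm ξ η a σ n x) (ε : ℂ)
    (by rw [dSpm, dS_zero, s0_sq hax.le]) (sum_antidiagonal_dS hs0) N

namespace PointwiseBounds

theorem norm_exp_expo_le (h : PointwiseBounds ξ η a M K₁ K₂)
    (hN : IsGeometricTruncation (ε * K₂) q N) (hε : 0 < ε) (hq : 0 ≤ q) (hq1 : q < 1) (σ : ℤˣ)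
    {x : ℝ} (hx : x ∈ Icc ξ η) :
    ‖Complex.exp (expo ξ η a ε N σ x)‖
      ≤ Real.exp ((η - ξ) * M * K₂ * (1 / (1 - q) ^ 2)) := by
  have hsplit : expo ξ η a ε N σ x
      = ∑ n ∈ Finset.range N, (ε : ℂ) ^ n * Spm ξ η a σ (n + 1) x
        + ((ε⁻¹ : ℝ) : ℂ) * Spm ξ η a σ 0 x := by
    rw [expo, Finset.sum_range_succ']
    simp
  rw [Complex.norm_exp, hsplit, Complex.add_re, Complex.re_ofReal_mul, Spm_zero_re, mul_zero,
    add_zero]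
  gcongr
  exact (Complex.re_le_norm _).trans (hN.norm_sum_pow_mul_le (f := fun n => Spm ξ η a σ n x) hε.le
    h.K₂_pos.le (mul_nonneg (sub_nonneg.2 h.lt.le) h.M_nonneg) hq hq1
    fun n => h.norm_Spm_le σ n x hx)

theorem norm_slope_sub_le (h : PointwiseBounds ξ η a M K₁ K₂)
    (hN : IsGeometricTruncation (ε * K₂) q N) (hε : 0 < ε) (hq : 0 ≤ q) (hq1 : q < 1) (σ : ℤˣ)
    {x : ℝ} (hx : x ∈ Icc ξ η) :
    ‖slope ξ η a ε N σ x - s0 a σ x‖ ≤ ε * (M * K₂ * (1 / (1 - q) ^ 2)) := by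
  have hsplit : slope ξ η a ε N σ x - s0 a σ x
      = ε * ∑ n ∈ Finset.range N, (ε : ℂ) ^ n * dSpm ξ η a σ (n + 1) x := by
    rw [slope, Finset.sum_range_succ', Finset.mul_sum]
    simp [dSpm, dS_zero, pow_succ', mul_assoc]
  rw [hsplit, norm_mul, Complex.norm_real, Real.norm_of_nonneg hε.le]
  gcongr
  exact hN.norm_sum_pow_mul_le (f := fun n => dSpm ξ η a σ n x) hε.le h.K₂_pos.le h.M_nonneg
    hq hq1 fun n => h.norm_dSpm_le σ n x hx

theorem le_norm_denom (h : PointwiseBounds ξ η a M K₁ K₂)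
    (hN : IsGeometricTruncation (ε * K₂) q N) (hε : 0 < ε) (hq : 0 ≤ q) (hq1 : q < 1) :
    2 * √(a ξ) - 2 * (ε * (M * K₂ * (1 / (1 - q) ^ 2))) ≤ ‖denom ξ η a ε N‖ := by
  have hξ := left_mem_Icc.2 h.lt.le
  have hsplit : 2 * s0 a 1 ξ = denom ξ η a ε N - ((slope ξ η a ε N 1 ξ - s0 a 1 ξ)
      - (slope ξ η a ε N (-1) ξ - s0 a (-1) ξ)) := by
    rw [denom_eq, s0_neg_one]
    ring
  have hnorm : 2 * √(a ξ) ≤ ‖denom ξ η a ε N‖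
      + (‖slope ξ η a ε N 1 ξ - s0 a 1 ξ‖ + ‖slope ξ η a ε N (-1) ξ - s0 a (-1) ξ‖) := by
    rw [← norm_s0 1 ξ, ← Complex.norm_ofNat 2, ← norm_mul, hsplit]
    exact norm_sub_le_of_le le_rfl (norm_sub_le _ _)
  have hplus := h.norm_slope_sub_le hN hε hq hq1 1 hξ
  have hminus := h.norm_slope_sub_le hN hε hq hq1 (-1) hξ
  linarith

theorem norm_slope_left_le (h : PointwiseBounds ξ η a M K₁ K₂)
    (hN : IsGeometricTruncation (ε * K₂) q N) (hε : 0 < ε) (hε1 : ε ≤ 1) (hq : 0 ≤ q)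
    (hq1 : q < 1) (σ : ℤˣ) :
    ‖slope ξ η a ε N σ ξ‖ ≤ √(a ξ) + M * K₂ * (1 / (1 - q) ^ 2) := by
  have hpos : 0 ≤ M * K₂ * (1 / (1 - q) ^ 2) :=
    mul_nonneg (mul_nonneg h.M_nonneg h.K₂_pos.le) (by positivity)
  rw [← norm_s0 σ ξ]
  exact (norm_le_norm_add_norm_sub' _ _).trans (add_le_add_right
    ((h.norm_slope_sub_le hN hε hq hq1 σ (left_mem_Icc.2 h.lt.le)).trans
      (mul_le_of_le_one_left hpos hε1)) _)

theorem norm_riccatiResidual_le (h : PointwiseBounds ξ η a M K₁ K₂) (hN1 : 1 ≤ N)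
    (hN : IsGeometricTruncation (ε * K₂) q N) (hε : 0 < ε) (hq : 0 ≤ q) (hq1 : q < 1) (σ : ℤˣ)
    {x : ℝ} (hx : x ∈ Icc ξ η) (hax : 0 < a x) :
    ‖riccatiResidual ξ η a ε N σ x‖
      ≤ (M * K₁ * K₂ + (M * K₂) ^ 2) * (ε ^ 2 * (N ^ 4 * q ^ (N - 1))) := by
  have hM := h.M_nonneg
  have hK₁ := h.K₁_pos
  have hK₂ := h.K₂_pos
  rw [riccatiResidual_eq h.lt (fun n => (h.contDiffOn σ n).differentiableOn one_ne_zero) hx hax,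
    add_mul]
  refine norm_add_le_of_le ?_
    (hN.norm_sum_pairs_le (f := fun n => dSpm ξ η a σ n x) hε.le hK₂.le hM hq hq1.le
      fun n => h.norm_dSpm_le σ n x hx)
  calc ‖(ε : ℂ) ^ (N + 1) * derivWithin (dSpm ξ η a σ N) (Icc ξ η) x‖
      = ε * ‖(ε : ℂ) ^ N * derivWithin (dSpm ξ η a σ N) (Icc ξ η) x‖ := by
        rw [pow_succ', mul_assoc, norm_mul, Complex.norm_real, Real.norm_of_nonneg hε.le]
    _ ≤ ε * (M * K₁ * K₂ * (ε * N) * q ^ (N - 1)) := by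
        gcongr
        exact hN.norm_pow_mul_le_of_mem_Icc
          (f := fun n => derivWithin (dSpm ξ η a σ n) (Icc ξ η) x) hε.le hK₂.le (by positivity) hq
          (fun n => h.norm_derivWithin_dSpm_le σ n x hx) (Finset.right_mem_Icc.2 hN1)
    _ = M * K₁ * K₂ * (ε ^ 2 * (N * q ^ (N - 1))) := by ring
    _ ≤ M * K₁ * K₂ * (ε ^ 2 * (N ^ 4 * q ^ (N - 1))) := by
        gcongr
        exact le_self_pow₀ (by exact_mod_cast hN1) four_ne_zero

theorem exists_error_le (h : PointwiseBounds ξ η a M K₁ K₂) {a₀ : ℝ} (ha₀ : 0 < a₀)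
    (ha : ∀ x ∈ Icc ξ η, a₀ ≤ a x) (hq : 0 ≤ q) (hq1 : q < 1) (R : ℝ) :
    ∃ C : ℝ, 0 ≤ C ∧ ∀ (ε : ℝ) (N : ℕ), 0 < ε → ε ≤ 1 → 1 ≤ N →
      IsGeometricTruncation (ε * K₂) q N → √a₀ ≤ ‖denom ξ η a ε N‖ →
      ∀ (φ₀ φ₁ : ℂ) (φ : ℝ → ℂ), ‖φ₀‖ ≤ R → ‖φ₁‖ ≤ R → IsSolution ξ η a ε φ₀ φ₁ φ →
        error ξ η a ε φ₀ φ₁ φ N ≤ ENNReal.ofReal (C * (ε * (N ^ 4 * q ^ (N - 1)))) := by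
  have hpos : ∀ x ∈ Icc ξ η, 0 < a x := fun x hx => ha₀.trans_le (ha x hx)
  have haC : ContDiffOn ℝ 1 a (Icc ξ η) :=
    contDiffOn_of_contDiffOn_s0 (σ := 1) (fun x hx => (hpos x hx).le)
      (by simpa only [dSpm, dS_zero] using h.contDiffOn 1 0)
  obtain ⟨A, hA⟩ := isCompact_Icc.exists_bound_of_continuousOn
    (haC.continuousOn_derivWithin (uniqueDiffOn_Icc h.lt) le_rfl)
  have hM := h.M_nonneg
  have hK₁ := h.K₁_pos
  have hK₂ := h.K₂_pos
  set Γ := |R| * (√(a ξ) + M * K₂ * (1 / (1 - q) ^ 2) + 1) / √a₀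
  set W := Real.exp ((η - ξ) * M * K₂ * (1 / (1 - q) ^ 2))
  set ρ := M * K₁ * K₂ + (M * K₂) ^ 2
  refine ⟨√(Real.exp ((A / a₀ + 1) * (η - ξ)) / a₀) * (2 * (Γ * (ρ * W))), by positivity,
    fun ε N hε hε1 hN1 hN hD φ₀ φ₁ φ h₀ h₁ hφ => ?_⟩
  have hsq : 0 < √a₀ := Real.sqrt_pos.2 ha₀
  have hslope := h.norm_slope_left_le hN hε hε1 hq hq1
  have hα := norm_alpha_le (h₀.trans (le_abs_self R)) (h₁.trans (le_abs_self R)) (hslope 1) hsq hD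
  have hβ := norm_beta_le (h₀.trans (le_abs_self R)) (h₁.trans (le_abs_self R)) (hslope (-1))
    hsq hD
  have hF : ∀ x ∈ Icc ξ η, ‖phiWKBResidual ξ η a ε φ₀ φ₁ N x‖
      ≤ 2 * (Γ * (ρ * (ε ^ 2 * (N ^ 4 * q ^ (N - 1))) * W)) := fun x hx =>
    norm_phiWKBResidual_le hα hβ
      (fun σ => h.norm_riccatiResidual_le hN1 hN hε hq hq1 σ hx (hpos x hx))
      fun σ => h.norm_exp_expo_le hN hε hq hq1 σ hx
  refine linftyNorm_le_of_forall measurableSet_Icc fun x hx =>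
    (norm_sub_phiWKB_le h.lt hε ha₀ ha
      (fun x hx => (haC.differentiableOn one_ne_zero x hx).hasDerivWithinAt) hA
      (fun σ n => (h.contDiffOn σ n).differentiableOn one_ne_zero)
      (norm_pos_iff.1 (hsq.trans_le hD)) hF hφ hx).trans_eq ?_
  field_simp

end PointwiseBounds

end Ingredients

/-! ### Truncation at an order proportional to `1 / ε` -/

theorem log_exp_one_div_two : Real.log (Real.exp 1 / 2) = 1 - Real.log 2 := by
  rw [Real.log_div (Real.exp_ne_zero 1) two_ne_zero, Real.log_exp]

theorem log_exp_one_div_two_pos : 0 < Real.log (Real.exp 1 / 2) := by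
  rw [log_exp_one_div_two]
  linarith [Real.log_two_lt_d9]

theorem floor_pow_mul_exp_le {y : ℝ} (hy : 1 ≤ y) :
    (⌊y⌋₊ : ℝ) ^ 4 * Real.exp (-1) ^ (⌊y⌋₊ - 1)
      ≤ Real.exp 2 / Real.log 2 * y ^ 3 * Real.exp (-(Real.log (Real.exp 1 / 2) * y)) := by
  have hlog : 0 < Real.log 2 := Real.log_pos one_lt_two
  have hfloor : (⌊y⌋₊ : ℝ) ≤ y := Nat.floor_le (by linarith)
  have hexp : Real.exp (-1) ^ (⌊y⌋₊ - 1) ≤ Real.exp (2 - y) := by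
    rw [← Real.exp_nat_mul, Nat.cast_pred (Nat.floor_pos.2 hy)]
    gcongr
    linarith [Nat.lt_floor_add_one y]
  have habsorb : y ≤ Real.exp (Real.log 2 * y) / Real.log 2 := by
    rw [le_div_iff₀ hlog]
    linarith [Real.add_one_le_exp (Real.log 2 * y)]
  calc (⌊y⌋₊ : ℝ) ^ 4 * Real.exp (-1) ^ (⌊y⌋₊ - 1)
      ≤ y ^ 4 * Real.exp (2 - y) := by gcongr
    _ = y ^ 3 * Real.exp (2 - y) * y := by ring
    _ ≤ y ^ 3 * Real.exp (2 - y) * (Real.exp (Real.log 2 * y) / Real.log 2) := by gcongr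
    _ = y ^ 3 / Real.log 2 * Real.exp (2 - y + Real.log 2 * y) := by
      rw [Real.exp_add]
      ring
    _ = y ^ 3 / Real.log 2 * (Real.exp 2 * Real.exp (-(Real.log (Real.exp 1 / 2) * y))) := by
      rw [← Real.exp_add, log_exp_one_div_two]
      ring_nf
    _ = Real.exp 2 / Real.log 2 * y ^ 3 * Real.exp (-(Real.log (Real.exp 1 / 2) * y)) := by ring

theorem mul_floor_pow_mul_exp_le {κ ε : ℝ} (hε : 0 < ε) (hκ : ε ≤ κ) :
    ε * ((⌊κ / ε⌋₊ : ℝ) ^ 4 * Real.exp (-1) ^ (⌊κ / ε⌋₊ - 1))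
      ≤ Real.exp 2 / Real.log 2 * κ ^ 3 / ε ^ 2
        * Real.exp (-(Real.log (Real.exp 1 / 2) * (κ / ε))) :=
  (mul_le_mul_of_nonneg_left (floor_pow_mul_exp_le ((one_le_div hε).2 hκ)) hε.le).trans_eq
    (by field_simp)

/-- The truncation order: `κ / ε`, rounded down, while `ε ≤ ε₀`. Beyond `ε₀` it is `1`, an order at
which `denom` does not depend on `ε`, since `S₁'` is the same for both signs. -/
def truncationOrder (κ ε₀ ε : ℝ) : ℕ :=
  if ε ≤ ε₀ then ⌊κ / ε⌋₊ else 1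

section TruncationOrder

variable {κ ε₀ ε : ℝ}

theorem truncationOrder_of_le (h : ε ≤ ε₀) : truncationOrder κ ε₀ ε = ⌊κ / ε⌋₊ := if_pos h

theorem truncationOrder_of_lt (h : ε₀ < ε) : truncationOrder κ ε₀ ε = 1 := if_neg h.not_ge

theorem one_le_truncationOrder (hε : 0 < ε) (hκ : ε₀ ≤ κ) : 1 ≤ truncationOrder κ ε₀ ε := by
  rcases le_or_gt ε ε₀ with hle | hlt
  · rw [truncationOrder_of_le hle, Nat.one_le_floor_iff, one_le_div hε]
    exact hle.trans hκ
  · rw [truncationOrder_of_lt hlt]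

theorem isGeometricTruncation_truncationOrder {K : ℝ} (hε : 0 < ε) (hK : 0 ≤ K) (hκ : 0 ≤ κ) :
    IsGeometricTruncation (ε * K) (K * κ) (truncationOrder κ ε₀ ε) := by
  rcases le_or_gt ε ε₀ with hle | hlt
  · rw [truncationOrder_of_le hle]
    refine isGeometricTruncation_of_mul_le (by positivity) ?_
    calc ε * K * ⌊κ / ε⌋₊ ≤ ε * K * (κ / ε) := by
          gcongr
          exact Nat.floor_le (by positivity)
      _ = K * κ := by field_simp
  · rw [truncationOrder_of_lt hlt]
    exact isGeometricTruncation_one _ _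

theorem exists_mul_truncationOrder_pow_mul_exp_le (hε₀ : 0 < ε₀) (hκ : ε₀ ≤ κ) :
    ∃ C > 0, ∀ ε > 0, ε ≤ 1 →
      ε * ((truncationOrder κ ε₀ ε : ℝ) ^ 4 * Real.exp (-1) ^ (truncationOrder κ ε₀ ε - 1))
        ≤ C / ε ^ 2 * Real.exp (-(Real.log (Real.exp 1 / 2) * (κ / ε))) := by
  set b := Real.log (Real.exp 1 / 2)
  have hb : 0 < b := log_exp_one_div_two_pos
  have hκ0 : 0 < κ := hε₀.trans_le hκ
  set C₁ := Real.exp 2 / Real.log 2 * κ ^ 3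
  set C₂ := Real.exp (b * (κ / ε₀))
  have hC₁ : 0 < C₁ := by positivity
  have hC₂ : 0 < C₂ := Real.exp_pos _
  refine ⟨C₁ + C₂, by positivity, fun ε hε hε1 => ?_⟩
  rcases le_or_gt ε ε₀ with hle | hlt
  · rw [truncationOrder_of_le hle]
    refine (mul_floor_pow_mul_exp_le hε (hle.trans hκ)).trans ?_
    gcongr
    exact le_add_of_nonneg_right hC₂.le
  · rw [truncationOrder_of_lt hlt]
    have hexp : 1 ≤ C₂ * Real.exp (-(b * (κ / ε))) := by
      rw [← Real.exp_add, ← sub_eq_add_neg]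
      refine Real.one_le_exp (sub_nonneg.2 ?_)
      gcongr
    calc ε * (((1 : ℕ) : ℝ) ^ 4 * Real.exp (-1) ^ (1 - 1)) = ε := by simp
      _ ≤ 1 / ε ^ 2 := hε1.trans ((one_le_div (by positivity)).2 (pow_le_one₀ hε.le hε1))
      _ ≤ C₂ * Real.exp (-(b * (κ / ε))) / ε ^ 2 := by gcongr
      _ = C₂ / ε ^ 2 * Real.exp (-(b * (κ / ε))) := by ring
      _ ≤ (C₁ + C₂) / ε ^ 2 * Real.exp (-(b * (κ / ε))) := by
          gcongr
          exact le_add_of_nonneg_left hC₁.le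

end TruncationOrder

namespace PointwiseBounds

variable {ξ η : ℝ} {a : ℝ → ℝ} {a₀ M K₁ K₂ κ : ℝ}

theorem exists_le_norm_denom_truncationOrder (h : PointwiseBounds ξ η a M K₁ K₂) (ha₀ : 0 < a₀)
    (ha : a₀ ≤ a ξ) (hκ : 0 < κ) (hκ1 : K₂ * κ < 1) :
    ∃ ε₀ ∈ Ioo (0 : ℝ) 1, ε₀ ≤ κ ∧
      ∀ ε > 0, √a₀ ≤ ‖denom ξ η a ε (truncationOrder κ ε₀ ε)‖ := by
  have hM := h.M_nonneg
  have hK₂ := h.K₂_pos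
  have hsqrt : √a₀ ≤ √(a ξ) := Real.sqrt_le_sqrt ha
  have hsqrt0 : 0 < √a₀ := Real.sqrt_pos.2 ha₀
  set X := M * K₂ * (1 / (1 - K₂ * κ) ^ 2)
  have : 0 ≤ X := by positivity
  set ε₀ := min (1 / 2) (min κ (√a₀ / (2 * (X + 1))))
  have hε₀κ : ε₀ ≤ κ := (min_le_right _ _).trans (min_le_left _ _)
  have hε₀X : ε₀ ≤ √a₀ / (2 * (X + 1)) := (min_le_right _ _).trans (min_le_right _ _)
  refine ⟨ε₀, ⟨by positivity, (min_le_left _ _).trans_lt (by norm_num)⟩, hε₀κ, fun ε hε => ?_⟩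
  rcases le_or_gt ε ε₀ with hle | hlt
  · have hgeom : IsGeometricTruncation (ε * K₂) (K₂ * κ) (truncationOrder κ ε₀ ε) :=
      isGeometricTruncation_truncationOrder hε hK₂.le hκ.le
    have hdenom := h.le_norm_denom hgeom hε (by positivity) hκ1
    have hsmall : ε * (2 * (X + 1)) ≤ √a₀ := (le_div_iff₀ (by positivity)).1 (hle.trans hε₀X)
    linarith
  · rw [truncationOrder_of_lt hlt, denom_one, norm_mul, norm_s0, Complex.norm_ofNat]
    linarith

theorem exists_truncation (h : PointwiseBounds ξ η a M K₁ K₂) (ha₀ : 0 < a₀)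
    (ha : ∀ x ∈ Icc ξ η, a₀ ≤ a x) :
    ∃ N : ℝ → ℕ, (∀ ε ∈ Ioo (0 : ℝ) 1, 1 ≤ N ε ∧ denom ξ η a ε (N ε) ≠ 0) ∧
      (∃ κ > (0 : ℝ), ∃ ε₀ ∈ Ioo (0 : ℝ) 1, ∀ ε ∈ Ioc (0 : ℝ) ε₀, N ε = ⌊κ / ε⌋₊) ∧
      ∀ R : ℝ, ∃ C > (0 : ℝ), ∀ ε ∈ Ioo (0 : ℝ) 1, ∀ (φ₀ φ₁ : ℂ) (φ : ℝ → ℂ),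
        ‖φ₀‖ ≤ R → ‖φ₁‖ ≤ R → IsSolution ξ η a ε φ₀ φ₁ φ →
          error ξ η a ε φ₀ φ₁ φ (N ε) ≤ ENNReal.ofReal (C / ε ^ 2 *
            Real.exp (-(Real.log (Real.exp 1 / 2) / (Real.exp 1 * K₂ * ε)))) := by
  have hK₂ := h.K₂_pos
  set κ := 1 / (Real.exp 1 * K₂) with hκ
  have hκ0 : 0 < κ := by positivity
  have hκK : K₂ * κ = Real.exp (-1) := by
    rw [hκ, Real.exp_neg]
    field_simp
  have hq1 : Real.exp (-1) < 1 := Real.exp_lt_one_iff.2 (by norm_num)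
  obtain ⟨ε₀, hε₀, hε₀κ, hD⟩ :=
    h.exists_le_norm_denom_truncationOrder ha₀ (ha ξ (left_mem_Icc.2 h.lt.le)) hκ0 (hκK ▸ hq1)
  refine ⟨truncationOrder κ ε₀, fun ε hε => ⟨one_le_truncationOrder hε.1 hε₀κ,
    norm_pos_iff.1 ((Real.sqrt_pos.2 ha₀).trans_le (hD ε hε.1))⟩,
    ⟨κ, hκ0, ε₀, hε₀, fun ε hε => truncationOrder_of_le hε.2⟩, fun R => ?_⟩
  obtain ⟨C, hC, herr⟩ := h.exists_error_le ha₀ ha (Real.exp_pos _).le hq1 R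
  obtain ⟨C', hC', hweight⟩ := exists_mul_truncationOrder_pow_mul_exp_le hε₀.1 hε₀κ
  refine ⟨(C + 1) * C', by positivity, fun ε hε φ₀ φ₁ φ h₀ h₁ hφ => ?_⟩
  have hε0 := hε.1
  refine (herr ε _ hε0 hε.2.le (one_le_truncationOrder hε0 hε₀κ)
    (hκK ▸ isGeometricTruncation_truncationOrder hε0 hK₂.le hκ0.le) (hD ε hε0) φ₀ φ₁ φ h₀ h₁
    hφ).trans (ENNReal.ofReal_le_ofReal ?_)
  have hrate : Real.log (Real.exp 1 / 2) / (Real.exp 1 * K₂ * ε)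
      = Real.log (Real.exp 1 / 2) * (κ / ε) := by
    rw [hκ, div_div, mul_one_div]
  rw [hrate, mul_div_assoc, mul_assoc]
  exact mul_le_mul (le_add_of_nonneg_right zero_le_one) (hweight ε hε0 hε.2.le) (by positivity)
    (by positivity)

end PointwiseBounds

end WKB

end

theorem corollary3
    (ξ η : ℝ) (hξη : ξ < η)
    (a : ℝ → ℝ) (a₀ : ℝ) (ha₀ : 0 < a₀) (ha : ∀ x ∈ Icc ξ η, a₀ ≤ a x)
    -- `s` is the analytic extension of `S_0' = i √a` to the complex neighbourhood `G`
    (G : Set ℂ) (hG : IsOpen G) (hIG : ∀ x ∈ Icc ξ η, (x : ℂ) ∈ G)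
    (s : ℂ → ℂ) (hs : DifferentiableOn ℂ s G)
    (hsI : ∀ x ∈ Icc ξ η, s (x : ℂ) = Complex.I * (Real.sqrt (a x) : ℂ))
    (hsG : WKB.linftyNorm s G < ⊤) :
    (∃ K₁ K₂ : ℝ, WKB.SeriesBounds ξ η a (WKB.linftyNorm s G) K₁ K₂) ∧
    ∀ K₁ K₂ : ℝ, WKB.SeriesBounds ξ η a (WKB.linftyNorm s G) K₁ K₂ →
      ∃ N : ℝ → ℕ,
        -- the approximation of order `N ε` is well defined
        (∀ ε ∈ Ioo (0 : ℝ) 1, 1 ≤ N ε ∧ WKB.denom ξ η a ε (N ε) ≠ 0) ∧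
        -- `N ε` is proportional to `1 / ε` (up to rounding) for small `ε`
        (∃ κ > (0 : ℝ), ∃ ε₀ ∈ Ioo (0 : ℝ) 1, ∀ ε ∈ Ioc (0 : ℝ) ε₀, N ε = ⌊κ / ε⌋₊) ∧
        ∃ c > (0 : ℝ), ∀ R : ℝ, ∃ C₁ > (0 : ℝ), ∃ C₂ > (0 : ℝ), ∃ C₃ > (0 : ℝ),
          ∀ ε ∈ Ioo (0 : ℝ) 1, ∀ (φ₀ φ₁ : ℂ) (φ : ℝ → ℂ), ‖φ₀‖ ≤ R → ‖φ₁‖ ≤ R →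
            WKB.IsSolution ξ η a ε φ₀ φ₁ φ →
              WKB.error ξ η a ε φ₀ φ₁ φ (N ε) ≤ ENNReal.ofReal
                (C₁ / ε * Real.exp (-(1 / (Real.exp 1 * K₂ * ε)))
                  + C₂ / ε ^ 2 *
                    Real.exp (-(Real.log (Real.exp 1 / 2) / (Real.exp 1 * K₂ * ε)))) ∧
              WKB.optimalError ξ η a ε φ₀ φ₁ φ
                ≤ ENNReal.ofReal (C₃ / ε ^ 2 * Real.exp (-(c / ε))) := by
  have hext : WKB.HolomorphicExtension (WKB.s0 a 1) (Icc ξ η) s G :=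
    ⟨hG, hIG, hs, fun x hx => by simp [WKB.s0, hsI x hx]⟩
  have hm : 0 < √a₀ / 2 := half_pos (Real.sqrt_pos.2 ha₀)
  obtain ⟨δ, hδ, hδG, hextδ, hsm⟩ := hext.exists_thickening isCompact_Icc fun x hx => by
    rw [WKB.norm_s0]
    exact (half_lt_self (Real.sqrt_pos.2 ha₀)).trans_le (Real.sqrt_le_sqrt (ha x hx))
  have hsM := WKB.norm_le_toReal_linftyNorm hG hs.continuousOn hsG
  rw [← ENNReal.ofReal_toReal hsG.ne]
  refine ⟨WKB.exists_seriesBounds hξη hδ hm hextδ hsm fun z hz => hsM z (hδG hz),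
    fun K₁ K₂ h => ?_⟩
  have hbounds := h.pointwiseBounds hξη ENNReal.toReal_nonneg fun σ n =>
    (WKB.holomorphicExtension_dSpm hξη hextδ
      (fun z hz => norm_pos_iff.1 (hm.trans_le (hsm z hz))) σ n).contDiffOn 1
  obtain ⟨N, hN, hκ, herr⟩ := hbounds.exists_truncation ha₀ ha
  refine ⟨N, hN, hκ, Real.log (Real.exp 1 / 2) / (Real.exp 1 * K₂),
    div_pos WKB.log_exp_one_div_two_pos (mul_pos (Real.exp_pos 1) h.pos₂), fun R => ?_⟩
  obtain ⟨C, hC, hCerr⟩ := herr R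
  refine ⟨1, one_pos, C, hC, C, hC, fun ε hε φ₀ φ₁ φ h₀ h₁ hφ => ?_⟩
  have hε0 := hε.1
  have herror := hCerr ε hε φ₀ φ₁ φ h₀ h₁ hφ
  refine ⟨herror.trans (ENNReal.ofReal_le_ofReal (le_add_of_nonneg_left (by positivity))), ?_⟩
  rw [div_div]
  exact (iInf₂_le (N ε) (hN ε hε).2).trans herror
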